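/- Let $V$ be a complex vector space of dimension $2h$ with a non-degenerate quadratic form $Q$, and let $V=E\oplus F$ with $E,F$ maximal totally isotropic subspaces. Let $S(V,Q)=Cl(E,Q|_E)$ be the space of spinors and $S(V,Q)_+=Cl(E,Q|_E)_+$ the space of even spinors, of dimension $2^{h-1}$. For a maximal totally isotropic subspace $W\subset V$ let $f_W\in Cl(V,Q)$ be the product of the vectors of a basis of $W$, and let $f=f_F$. A spinor $s\neq 0$ is called pure if $s f\in Cl(V,Q)f\cap f_W\,Cl(V,Q)$ for some such $W$. Let $S_h\subset\mathbb P(S(V,Q)_+)=\mathbb P^{N}$, $N=2^{h-1}-1$, be the variety of even pure spinors, i.e. the set of classes of pure spinors lying in $S(V,Q)_+$. For $X\subseteq\mathbb P^N$ let $\sigma_k(X)$ be the Zariski closure of the union of the linear spaces $\langle x_1,\dots,x_k\rangle$ with $x_1,\dots,x_k\in X$; it is said to have the expected dimension if $\dim\sigma_k(X)=\min\{k\dim X+k-1,\,N\}$. **Theorem.** For all $h\ge 12$, the variety $\sigma_3(S_h)$ has the expected dimension, and this dimension is $$\dim_{\mathbb C}\sigma_3(S_h)=3\cdot\frac{h(h-1)}{2}+2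 .$$ -/

import Mathlib

open scoped LinearAlgebra.Projectivization

noncomputable section

namespace SpinorSecant

section ProjectiveGeometry

variable {W : Type*} [AddCommGroup W] [Module ℂ W]

/-- The points of `ℙ(W)` at which the polynomial `p` does not vanish. The variables are indexed by
the linear forms on `W`, so that polynomials in them give all polynomial functions on `W`. For
homogeneous `p` the condition does not depend on the representative of the point. -/
def basicOpen (p : MvPolynomial (Module.Dual ℂ W) ℂ) : Set (ℙ ℂ W) :=
  {x | MvPolynomial.eval (fun φ : Module.Dual ℂ W => φ x.rep) p ≠ 0}

/-- The Zariski topology on the projective space `ℙ(W)`: the open sets are generated by the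
non-vanishing loci of homogeneous polynomials. -/
instance zariskiTopology : TopologicalSpace (ℙ ℂ W) :=
  TopologicalSpace.generateFrom {U | ∃ (p : MvPolynomial (Module.Dual ℂ W) ℂ) (d : ℕ),
    p.IsHomogeneous d ∧ U = basicOpen p}

/-- The dimension of a subset of projective space: the Krull dimension of its (induced) Zariski
topology, i.e. the supremum of the lengths of chains of irreducible closed subsets. -/
def zariskiDim (X : Set (ℙ ℂ W)) : WithBot ℕ∞ := topologicalKrullDim X

/-- The `k`-secant variety `σ_k(X)`: the Zariski closure of the union of the linear spaces
`⟨x_1, …, x_k⟩` spanned by `k` points of `X`. -/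
def secantVariety (k : ℕ) (X : Set (ℙ ℂ W)) : Set (ℙ ℂ W) :=
  closure {y | ∃ x : Fin k → ℙ ℂ W, (∀ i, x i ∈ X) ∧ y.submodule ≤ ⨆ i, (x i).submodule}

/-- For `k ≥ 1` and `X ⊆ ℙ(W) = ℙ^N` of dimension `d`, the variety `σ_k(X)` has the expected
dimension if `dim σ_k(X) = min (k d + k - 1) N`. -/
def HasExpectedDimension (k : ℕ) (X : Set (ℙ ℂ W)) : Prop :=
  ∃ d : ℕ, zariskiDim X = (d : WithBot ℕ∞) ∧
    zariskiDim (secantVariety k X) =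
      ((min (k * d + (k - 1)) (Module.finrank ℂ W - 1) : ℕ) : WithBot ℕ∞)

end ProjectiveGeometry

section Spinors

variable {V : Type*} [AddCommGroup V] [Module ℂ V]

/-- `W` is a totally isotropic subspace of `(V, Q)`. -/
def IsTotallyIsotropic (Q : QuadraticForm ℂ V) (W : Submodule ℂ V) : Prop :=
  ∀ w ∈ W, Q w = 0

/-- `W` is a maximal totally isotropic subspace of `(V, Q)`. -/
def IsMaximalTotallyIsotropic (Q : QuadraticForm ℂ V) (W : Submodule ℂ V) : Prop :=
  Maximal (IsTotallyIsotropic Q) W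

/-- `f` is the product in `Cl(V, Q)` of the vectors of some (ordered) basis of `W`. -/
def IsBasisProduct (Q : QuadraticForm ℂ V) (W : Submodule ℂ V) (f : CliffordAlgebra Q) : Prop :=
  ∃ (n : ℕ) (b : Module.Basis (Fin n) ℂ W),
    f = (List.ofFn fun i => CliffordAlgebra.ι Q (b i : V)).prod

/-- The space of spinors `S(V, Q) = Cl(E, Q|_E)`. -/
abbrev Spinors (Q : QuadraticForm ℂ V) (E : Submodule ℂ V) : Type _ :=
  CliffordAlgebra (Q.comp E.subtype)

/-- The natural map `Cl(E, Q|_E) → Cl(V, Q)` induced by the inclusion of `E` in `V`. -/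
def spinorsToClifford (Q : QuadraticForm ℂ V) (E : Submodule ℂ V) :
    Spinors Q E →ₐ[ℂ] CliffordAlgebra Q :=
  CliffordAlgebra.map { E.subtype with map_app' := fun _ => rfl }

/-- The space of even spinors `S(V, Q)_+ = Cl(E, Q|_E)_+`. -/
abbrev EvenSpinors (Q : QuadraticForm ℂ V) (E : Submodule ℂ V) : Submodule ℂ (Spinors Q E) :=
  CliffordAlgebra.evenOdd (Q.comp E.subtype) 0

/-- `s` is a representative spinor of `W`, with respect to the decomposition `V = E ⊕ F`: it is
non-zero and `s f` lies in `Cl(V, Q) f ∩ f_W Cl(V, Q)`, where `f` and `f_W` are products of the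
vectors of bases of `F` and of `W` (the choice of the bases changes `f` and `f_W` only by non-zero
scalars). -/
def IsRepresentativeSpinor (Q : QuadraticForm ℂ V) (E F W : Submodule ℂ V)
    (s : Spinors Q E) : Prop :=
  s ≠ 0 ∧ ∃ f fW x : CliffordAlgebra Q, IsBasisProduct Q F f ∧ IsBasisProduct Q W fW ∧
    spinorsToClifford Q E s * f = fW * x

/-- `s` is a pure spinor: a representative spinor of some maximal totally isotropic subspace. -/
def IsPureSpinor (Q : QuadraticForm ℂ V) (E F : Submodule ℂ V) (s : Spinors Q E) : Prop :=
  ∃ W : Submodule ℂ V, IsMaximalTotallyIsotropic Q W ∧ IsRepresentativeSpinor Q E F W s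

/-- The even pure spinors variety `S_h ⊆ ℙ(S(V, Q)_+)`, where `dim V = 2 h`. -/
def evenPureSpinorVariety (Q : QuadraticForm ℂ V) (E F : Submodule ℂ V) :
    Set (ℙ ℂ (EvenSpinors Q E)) :=
  {x | IsPureSpinor Q E F (x.rep : Spinors Q E)}

end Spinors

end SpinorSecant

end

/-!
Fix dual bases `e_i` of `E` and `f_i` of `F`. Since `E` is isotropic, the space of spinors is the
exterior algebra of `E`, and the Clifford algebra acts on it: vectors of `E` multiply, vectors of
`F` contract.

*Charts.* A pure spinor with nonzero component of degree zero belongs to the graph of a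
skew-symmetric map `F → E`, hence is a multiple of the exponential of a bivector
(`DualFrame.exists_eq_smul_expChart`). Flipping an index, i.e. letting the unit vector `e_i + f_i`
act, preserves purity and exchanges the basis spinors with and without a factor `e_i`; so every
even pure spinor can be moved into this chart by an even number of flips
(`DualFrame.exists_eq_smul_flipAct_expChart`). Thus `S_h` is a finite union of images of
polynomial maps in `h (h - 1) / 2` variables, and every secant plane lies in the union of the
images of finitely many polynomial maps in `3 * (h (h - 1) / 2) + 2` variables
(`DualFrame.secant_subset`).

*Upper bounds.* A strictly increasing chain of irreducible closed sets gives a strictly decreasing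
chain of prime ideals of polynomials vanishing on their cones, along which the transcendence
degree of the quotient increases strictly (`trdeg_quotient_lt`). The cone over the image of a
polynomial map in `n` variables has transcendence degree at most `n + 1`, so the image and its
closure have dimension at most `n` (`zariskiDim_le_of_subset_closure`).

*Lower bounds.* If the cone over a polynomial map has injective derivative at one point, then by
the inverse function theorem `n + 1` suitable linear forms take all values near a point, hence are
algebraically independent on the cone. Applied to all coordinate subspaces of the parameter space,
this yields a chain of `n + 1` irreducible closed sets (`le_zariskiDim_of_projImage_subset`). For
the secant variety the injectivity is Terracini's lemma: the affine tangent space of `S_h` at the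
basis spinor indexed by `I ⊆ {1, …, h}` is spanned by the basis spinors indexed by sets which
differ from `I` in zero or two elements. For `h ≥ 12` three subsets of even cardinality with
mutual symmetric differences of at least six elements exist, namely `∅`, `{1, …, 6}`, `{7, …,
12}`, and then the three tangent spaces are independent (`DualFrame.linearIndependent_tangent`).
This independence also shows that the expected dimension does not exceed the dimension of the
ambient projective space.
-/

noncomputable section

namespace SpinorSecant

section ZariskiDimension

open MvPolynomial Cardinal TopologicalSpace

/-! ### Transcendence degree of quotients -/

/-- The transcendence degree of the quotient drops along a strict inclusion of prime ideals: lift a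
transcendence basis of the smaller quotient. If it were still one of the larger quotient, every
nonzero element of that would divide a nonzero polynomial in it. -/
theorem trdeg_quotient_lt {k R : Type*} [Field k] [CommRing R] [Algebra k R] {p q : Ideal R}
    [p.IsPrime] [q.IsPrime] (hpq : p < q) (hfin : Algebra.trdeg k (R ⧸ p) < ℵ₀) :
    Algebra.trdeg k (R ⧸ q) < Algebra.trdeg k (R ⧸ p) := by
  obtain ⟨ι, x, hx⟩ := exists_isTranscendenceBasis' k (R ⧸ q)
  obtain ⟨y, hy⟩ : ∃ y : ι → R, ∀ i, Ideal.Quotient.mkₐ k q (y i) = x i :=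
    ⟨fun i => (Ideal.Quotient.mk_surjective (x i)).choose,
      fun i => (Ideal.Quotient.mk_surjective (x i)).choose_spec⟩
  set f : (R ⧸ p) →ₐ[k] (R ⧸ q) := Ideal.Quotient.factorₐ k hpq.le with hf
  set z : ι → R ⧸ p := fun i => Ideal.Quotient.mkₐ k p (y i) with hz
  have hfz : f ∘ z = x := by
    funext i
    rw [← hy i]
    rfl
  have hzi : AlgebraicIndependent k z :=
    AlgebraicIndependent.of_comp f (by rw [hfz]; exact hx.1)
  by_contra hlt
  rw [not_lt, ← hx.cardinalMk_eq_trdeg] at hlt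
  have hzb := hzi.isTranscendenceBasis_of_trdeg_le hfin hlt
  have halg := hzb.isAlgebraic
  obtain ⟨a, haq, hap⟩ := SetLike.exists_of_lt hpq
  have ha0 : Ideal.Quotient.mk p a ≠ 0 := by rwa [Ne, Ideal.Quotient.eq_zero_iff_mem]
  obtain ⟨c, hc0, hdvd⟩ := (halg.isAlgebraic (Ideal.Quotient.mk p a)).exists_nonzero_dvd
    (mem_nonZeroDivisors_of_ne_zero ha0)
  -- the nonzero multiple `c` of `a` is a polynomial in the `z i`, and it dies modulo `q`
  have hfc : f c = 0 := by
    obtain ⟨d, hd⟩ := hdvd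
    have : (c : R ⧸ p) = Ideal.Quotient.mk p a * d := hd
    rw [this, map_mul]
    have : f (Ideal.Quotient.mk p a) = 0 := Ideal.Quotient.eq_zero_iff_mem.2 haq
    rw [this, zero_mul]
  obtain ⟨P, hP⟩ : ∃ P : MvPolynomial ι k, aeval z P = (c : R ⧸ p) := by
    have h : (c : R ⧸ p) ∈ (aeval (R := k) z).range := by
      rw [← Algebra.adjoin_range_eq_range_aeval]
      exact c.2
    exact h
  have hP0 : P = 0 := by
    apply hx.1.eq_zero_of_aeval_eq_zero
    rw [← hfz, ← hfc, ← hP, Function.comp_def]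
    exact (MvPolynomial.comp_aeval_apply z f P).symm
  apply hc0
  ext
  rw [← hP, hP0, map_zero]
  rfl

/-! ### Ideals of cones -/

variable {W : Type*} [AddCommGroup W] [Module ℂ W]

/-- The value at the vector `v` of a polynomial in the linear forms on `W`. -/
def evalAt (v : W) : MvPolynomial (Module.Dual ℂ W) ℂ →+* ℂ :=
  MvPolynomial.eval fun φ : Module.Dual ℂ W => φ v

theorem evalAt_smul_of_isHomogeneous {p : MvPolynomial (Module.Dual ℂ W) ℂ} {d : ℕ}
    (hp : p.IsHomogeneous d) (c : ℂ) (v : W) : evalAt (c • v) p = c ^ d * evalAt v p := by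
  simp only [evalAt, MvPolynomial.eval_eq, map_smul, smul_eq_mul, mul_pow,
    Finset.prod_mul_distrib, Finset.mul_sum]
  refine Finset.sum_congr rfl fun m hm => ?_
  have hd : ∑ i ∈ m.support, m i = d := (hp.degree_eq_sum_deg_support hm).symm
  rw [Finset.prod_pow_eq_pow_sum, hd]
  ring

/-- The restriction of a polynomial function to the line through `v`. -/
theorem exists_polynomial_line (p : MvPolynomial (Module.Dual ℂ W) ℂ) (v : W) :
    ∃ P : Polynomial ℂ, (∀ c, P.eval c = evalAt (c • v) p) ∧
      ∀ i, P.coeff i = evalAt v (homogeneousComponent i p) := by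
  refine ⟨∑ i ∈ Finset.range (p.totalDegree + 1),
    Polynomial.C (evalAt v (homogeneousComponent i p)) * Polynomial.X ^ i, fun c => ?_, fun i => ?_⟩
  · conv_rhs => rw [← sum_homogeneousComponent p, map_sum]
    rw [Polynomial.eval_finsetSum]
    refine Finset.sum_congr rfl fun i _ => ?_
    rw [evalAt_smul_of_isHomogeneous (homogeneousComponent_isHomogeneous i p)]
    rw [Polynomial.eval_mul, Polynomial.eval_C, Polynomial.eval_pow, Polynomial.eval_X, mul_comm]
  · rw [Polynomial.finsetSum_coeff]
    simp only [Polynomial.coeff_C_mul, Polynomial.coeff_X_pow, mul_ite, mul_one, mul_zero]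
    rw [Finset.sum_ite_eq]
    split_ifs with h
    · rfl
    · rw [homogeneousComponent_eq_zero, map_zero]
      simpa using h

/-- The ideal of all polynomials vanishing on the cone over a subset of projective space. -/
def coneIdeal (Z : Set (ℙ ℂ W)) : Ideal (MvPolynomial (Module.Dual ℂ W) ℂ) where
  carrier := {p | ∀ v (hv : v ≠ 0), Projectivization.mk ℂ v hv ∈ Z → evalAt v p = 0}
  add_mem' {p q} hp hq v hv hZ := by rw [map_add, hp v hv hZ, hq v hv hZ, add_zero]
  zero_mem' v hv hZ := map_zero _
  smul_mem' c p hp v hv hZ := by rw [smul_eq_mul, map_mul, hp v hv hZ, mul_zero]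

theorem mk_smul_eq (v : W) (hv : v ≠ 0) (c : ℂ) (hc : c • v ≠ 0) :
    Projectivization.mk ℂ (c • v) hc = Projectivization.mk ℂ v hv :=
  (Projectivization.mk_eq_mk_iff' ℂ _ _ hc hv).2 ⟨c, rfl⟩

/-- The ideal of a cone is homogeneous: restrict a polynomial in it to the lines of the cone. -/
theorem homogeneousComponent_mem_coneIdeal {Z : Set (ℙ ℂ W)}
    {p : MvPolynomial (Module.Dual ℂ W) ℂ} (hp : p ∈ coneIdeal Z) (i : ℕ) :
    homogeneousComponent i p ∈ coneIdeal Z := by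
  intro v hv hZ
  obtain ⟨P, hP, hPc⟩ := exists_polynomial_line p v
  rw [← hPc]
  suffices P = 0 by rw [this, Polynomial.coeff_zero]
  refine Polynomial.eq_zero_of_infinite_isRoot P
    ((Set.finite_singleton (0 : ℂ)).infinite_compl.mono fun c hc => ?_)
  have hcv : c • v ≠ 0 := smul_ne_zero hc hv
  rw [Set.mem_ofPred_eq, Polynomial.IsRoot, hP]
  exact hp _ hcv (by rwa [mk_smul_eq v hv])

theorem mk_mem_basicOpen {p : MvPolynomial (Module.Dual ℂ W) ℂ} {d : ℕ} (hp : p.IsHomogeneous d)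
    (v : W) (hv : v ≠ 0) : Projectivization.mk ℂ v hv ∈ basicOpen p ↔ evalAt v p ≠ 0 := by
  obtain ⟨a, ha⟩ := Projectivization.exists_smul_eq_mk_rep ℂ v hv
  have : Projectivization.mk ℂ v hv ∈ basicOpen p ↔ evalAt ((a : ℂ) • v) p ≠ 0 := by
    rw [← Units.smul_def, ha]; rfl
  rw [this, evalAt_smul_of_isHomogeneous hp]
  simp

theorem isOpen_basicOpen {p : MvPolynomial (Module.Dual ℂ W) ℂ} {d : ℕ}
    (hp : p.IsHomogeneous d) : IsOpen (basicOpen p) :=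
  TopologicalSpace.isOpen_generateFrom_of_mem ⟨p, d, hp, rfl⟩

theorem isTopologicalBasis_basicOpen : TopologicalSpace.IsTopologicalBasis
    {U : Set (ℙ ℂ W) | ∃ (p : MvPolynomial (Module.Dual ℂ W) ℂ) (d : ℕ),
      p.IsHomogeneous d ∧ U = basicOpen p} where
  exists_subset_inter := by
    rintro _ ⟨p, d, hp, rfl⟩ _ ⟨q, e, hq, rfl⟩ x ⟨hx1, hx2⟩
    refine ⟨basicOpen (p * q), ⟨p * q, d + e, hp.mul hq, rfl⟩, ?_, fun y hy => ?_⟩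
    · simp only [basicOpen, Set.mem_ofPred_eq, map_mul] at *
      exact mul_ne_zero hx1 hx2
    · simp only [basicOpen, Set.mem_ofPred_eq, map_mul, mul_ne_zero_iff] at hy
      exact hy
  sUnion_eq := Set.eq_univ_of_forall fun x =>
    ⟨basicOpen 1, ⟨1, 0, isHomogeneous_one _ _, rfl⟩, by simp [basicOpen]⟩
  eq_generateFrom := rfl

/-- The Zariski closure is the zero locus of the ideal of the cone. -/
theorem mk_mem_closure_iff {Z : Set (ℙ ℂ W)} {v : W} (hv : v ≠ 0) :
    Projectivization.mk ℂ v hv ∈ closure Z ↔ ∀ p ∈ coneIdeal Z, evalAt v p = 0 := by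
  rw [isTopologicalBasis_basicOpen.mem_closure_iff]
  constructor
  · intro h p hp
    rw [← sum_homogeneousComponent p, map_sum]
    refine Finset.sum_eq_zero fun i _ => ?_
    by_contra hne
    have hi := homogeneousComponent_isHomogeneous i p
    obtain ⟨y, hy, hyZ⟩ := h _ ⟨_, i, hi, rfl⟩ ((mk_mem_basicOpen hi v hv).2 hne)
    induction y using Projectivization.ind with | h w hw =>
    exact (mk_mem_basicOpen hi w hw).1 hy (homogeneousComponent_mem_coneIdeal hp i w hw hyZ)
  · rintro h _ ⟨p, d, hp, rfl⟩ hvp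
    by_contra hne
    refine (mk_mem_basicOpen hp v hv).1 hvp (h p fun w hw hwZ => ?_)
    by_contra hwp
    exact hne ⟨_, (mk_mem_basicOpen hp w hw).2 hwp, hwZ⟩

theorem closure_subset_closure_iff {Z Z' : Set (ℙ ℂ W)} :
    closure Z ⊆ closure Z' ↔ coneIdeal Z' ≤ coneIdeal Z := by
  constructor
  · intro h p hp v hv hvZ
    exact (mk_mem_closure_iff hv).1 (h (subset_closure hvZ)) p hp
  · intro h x hx
    induction x using Projectivization.ind with | h v hv =>
    rw [mk_mem_closure_iff] at hx ⊢
    exact fun p hp => hx p (h hp)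

theorem coneIdeal_strictAnti_of_isClosed {Z Z' : Set (ℙ ℂ W)} (hZ : IsClosed Z)
    (hZ' : IsClosed Z') (h : Z ⊂ Z') : coneIdeal Z' < coneIdeal Z := by
  have key : ∀ {A B : Set (ℙ ℂ W)}, IsClosed A → IsClosed B →
      (A ⊆ B ↔ coneIdeal B ≤ coneIdeal A) := fun hA hB => by
    rw [← closure_subset_closure_iff, hA.closure_eq, hB.closure_eq]
  exact ⟨(key hZ hZ').1 h.1, fun h' => h.2 ((key hZ' hZ).2 h')⟩

theorem coneIdeal_isPrime {Z : Set (ℙ ℂ W)} (hZ : IsIrreducible Z) : (coneIdeal Z).IsPrime := by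
  constructor
  · rw [Ideal.ne_top_iff_one]
    intro h
    obtain ⟨x, hx⟩ := hZ.nonempty
    have := h x.rep x.rep_nonzero (by rwa [Projectivization.mk_rep])
    simp at this
  · intro p q hpq
    by_contra! hne
    have key : ∀ r : MvPolynomial (Module.Dual ℂ W) ℂ, r ∉ coneIdeal Z →
        ∃ i, (Z ∩ basicOpen (homogeneousComponent i r)).Nonempty := by
      intro r hr
      by_contra! hall
      refine hr fun v hv hvZ => ?_
      rw [← sum_homogeneousComponent r, map_sum]
      refine Finset.sum_eq_zero fun i _ => ?_
      by_contra hne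
      have : Projectivization.mk ℂ v hv ∈ Z ∩ basicOpen (homogeneousComponent i r) :=
        ⟨hvZ, (mk_mem_basicOpen (homogeneousComponent_isHomogeneous i r) v hv).2 hne⟩
      rw [hall i] at this
      exact this
    obtain ⟨i, hi⟩ := key p hne.1
    obtain ⟨j, hj⟩ := key q hne.2
    obtain ⟨x, hxZ, hxi, hxj⟩ := hZ.isPreirreducible _ _
      (isOpen_basicOpen (homogeneousComponent_isHomogeneous i p))
      (isOpen_basicOpen (homogeneousComponent_isHomogeneous j q)) hi hj
    induction x using Projectivization.ind with | h v hv =>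
    rw [mk_mem_basicOpen (homogeneousComponent_isHomogeneous _ _)] at hxi hxj
    obtain ⟨P, hP, hPc⟩ := exists_polynomial_line p v
    obtain ⟨P', hP', hPc'⟩ := exists_polynomial_line q v
    have hP0 : P ≠ 0 := fun h => hxi (by rw [← hPc, h, Polynomial.coeff_zero])
    have hP0' : P' ≠ 0 := fun h => hxj (by rw [← hPc', h, Polynomial.coeff_zero])
    refine mul_ne_zero hP0 hP0' (Polynomial.eq_zero_of_infinite_isRoot _
      ((Set.finite_singleton (0 : ℂ)).infinite_compl.mono fun c hc => ?_))
    have hcv : c • v ≠ 0 := smul_ne_zero hc hv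
    have := hpq _ hcv (by rwa [mk_smul_eq v hv])
    rw [Set.mem_ofPred_eq, Polynomial.IsRoot, Polynomial.eval_mul, hP, hP', ← map_mul]
    exact this

/-- The irrelevant ideal: the polynomials without constant term. -/
def irrelevantIdeal (W : Type*) [AddCommGroup W] [Module ℂ W] :
    Ideal (MvPolynomial (Module.Dual ℂ W) ℂ) := RingHom.ker (evalAt (0 : W))

instance : (irrelevantIdeal W).IsPrime := RingHom.ker_isPrime _

theorem coneIdeal_lt_irrelevantIdeal {Z : Set (ℙ ℂ W)} (hZ : Z.Nonempty) :
    coneIdeal Z < irrelevantIdeal W := by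
  obtain ⟨x, hx⟩ := hZ
  induction x using Projectivization.ind with | h v hv =>
  refine lt_of_le_of_ne (fun p hp => ?_) fun h => ?_
  · have h0 := homogeneousComponent_mem_coneIdeal hp 0 v hv hx
    have h1 := evalAt_smul_of_isHomogeneous (homogeneousComponent_isHomogeneous 0 p) 0 v
    obtain ⟨P, hP, hPc⟩ := exists_polynomial_line p v
    have := hP 0
    rw [zero_smul] at this
    rw [irrelevantIdeal, RingHom.mem_ker, ← this, ← Polynomial.coeff_zero_eq_eval_zero, hPc, h0]
  · obtain ⟨φ, hφ⟩ := Module.Projective.exists_dual_ne_zero ℂ hv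
    have hX : (X φ : MvPolynomial (Module.Dual ℂ W) ℂ) ∈ irrelevantIdeal W := by
      simp [irrelevantIdeal, RingHom.mem_ker, evalAt]
    rw [← h] at hX
    exact hφ (by simpa [evalAt] using hX v hv hx)

/-! ### Polynomial maps into projective space -/

section PolynomialMaps

variable {W : Type*} [AddCommGroup W] [Module ℂ W] {κ : Type*}

theorem eval_aeval_eq {R σ τ : Type*} [CommSemiring R] (f : σ → MvPolynomial τ R)
    (p : MvPolynomial σ R) (t : τ → R) :
    eval t (aeval f p) = eval (fun i => eval t (f i)) p := by
  rw [MvPolynomial.aeval_def, MvPolynomial.algebraMap_eq, MvPolynomial.eval_eval₂]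
  simp only [MvPolynomial.eval, MvPolynomial.coe_eval₂Hom]
  congr 1
  ext
  simp

/-- A map `ℂ^κ → W` is polynomial if every linear form of it is given by a polynomial. -/
def IsPolynomialMap (Φ : (κ → ℂ) → W) : Prop :=
  ∀ φ : Module.Dual ℂ W, ∃ p : MvPolynomial κ ℂ, ∀ t, eval t p = φ (Φ t)

/-- The points of projective space parametrized by a map into `W`, at the parameters where the map
does not vanish. -/
def projImage (Φ : (κ → ℂ) → W) : Set (ℙ ℂ W) :=
  {x | ∃ (t : κ → ℂ) (ht : Φ t ≠ 0), x = Projectivization.mk ℂ (Φ t) ht}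

theorem IsPolynomialMap.exists_eval_eq {Φ : (κ → ℂ) → W} (hΦ : IsPolynomialMap Φ)
    (p : MvPolynomial (Module.Dual ℂ W) ℂ) :
    ∃ P : MvPolynomial κ ℂ, ∀ t, eval t P = evalAt (Φ t) p := by
  choose f hf using hΦ
  refine ⟨aeval f p, fun t => ?_⟩
  rw [evalAt, ← funext fun φ => hf φ t, eval_aeval_eq]

theorem isIrreducible_projImage {Φ : (κ → ℂ) → W} (hΦ : IsPolynomialMap Φ)
    (hne : (projImage Φ).Nonempty) : IsIrreducible (projImage Φ) := by
  refine ⟨hne, ?_⟩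
  rintro U V hU hV ⟨x, hx, hxU⟩ ⟨y, hy, hyV⟩
  obtain ⟨_, ⟨p, d, hp, rfl⟩, hxp, hpU⟩ :=
    isTopologicalBasis_basicOpen.exists_subset_of_mem_open hxU hU
  obtain ⟨_, ⟨q, e, hq, rfl⟩, hyq, hqV⟩ :=
    isTopologicalBasis_basicOpen.exists_subset_of_mem_open hyV hV
  obtain ⟨t, ht, rfl⟩ := hx
  obtain ⟨s, hs, rfl⟩ := hy
  rw [mk_mem_basicOpen hp] at hxp
  rw [mk_mem_basicOpen hq] at hyq
  obtain ⟨φ, hφ⟩ := Module.Projective.exists_dual_ne_zero ℂ ht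
  obtain ⟨P, hP⟩ := hΦ.exists_eval_eq p
  obtain ⟨P', hP'⟩ := hΦ.exists_eval_eq q
  obtain ⟨F, hF⟩ := hΦ φ
  have hne : P * P' * F ≠ 0 := by
    refine mul_ne_zero (mul_ne_zero ?_ ?_) ?_
    · rintro rfl; rw [← hP] at hxp; simp at hxp
    · rintro rfl; rw [← hP'] at hyq; simp at hyq
    · rintro rfl; rw [← hF] at hφ; simp at hφ
  obtain ⟨u, hu⟩ : ∃ u, eval u (P * P' * F) ≠ 0 := by
    by_contra! h
    exact hne (MvPolynomial.funext fun u => by rw [h u, map_zero])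
  rw [map_mul, map_mul, hP, hP', hF] at hu
  have hu0 : Φ u ≠ 0 := fun h => right_ne_zero_of_mul hu (by rw [h, map_zero])
  refine ⟨_, ⟨u, hu0, rfl⟩, hpU ?_, hqV ?_⟩
  · exact (mk_mem_basicOpen hp _ hu0).2 (left_ne_zero_of_mul (left_ne_zero_of_mul hu))
  · exact (mk_mem_basicOpen hq _ hu0).2 (right_ne_zero_of_mul (left_ne_zero_of_mul hu))

/-- The cone over the map `Φ`. -/
def coneMap (Φ : (κ → ℂ) → W) (u : Option κ → ℂ) : W := u none • Φ fun i => u (some i)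

theorem IsPolynomialMap.coneMap {Φ : (κ → ℂ) → W} (hΦ : IsPolynomialMap Φ) :
    IsPolynomialMap (coneMap Φ) := by
  intro φ
  obtain ⟨p, hp⟩ := hΦ φ
  refine ⟨X none * rename some p, fun u => ?_⟩
  rw [map_mul, eval_X, eval_rename, SpinorSecant.coneMap, map_smul, smul_eq_mul, ← hp]
  rfl

theorem trdeg_mvPolynomial_of_finite (k σ : Type*) [Field k] [Finite σ] :
    Algebra.trdeg k (MvPolynomial σ k) = (Nat.card σ : Cardinal) := by
  rw [MvPolynomial.trdeg_of_isDomain, ← Nat.cast_card, lift_natCast]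

universe u v in
theorem lift_trdeg_quotient_le {k : Type*} {R : Type u} {S : Type v} [Field k]
    [CommRing R] [CommRing S] [Algebra k R] [Algebra k S] {I : Ideal R} (θ : R →ₐ[k] S)
    (hker : ∀ p, p ∈ I ↔ θ p = 0) :
    lift.{v} (Algebra.trdeg k (R ⧸ I)) ≤ lift.{u} (Algebra.trdeg k S) := by
  refine lift_trdeg_le_of_injective (Ideal.Quotient.liftₐ I θ fun p hp => (hker p).1 hp) ?_
  rw [injective_iff_map_eq_zero]
  intro x hx
  obtain ⟨p, rfl⟩ := Ideal.Quotient.mk_surjective x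
  rw [Ideal.Quotient.eq_zero_iff_mem, hker]
  exact hx

/-- The coordinate ring of the cone over the image of a polynomial map embeds into the polynomial
ring of the cone's parameters. -/
theorem trdeg_coneIdeal_projImage_le [Finite κ] {Φ : (κ → ℂ) → W} (hΦ : IsPolynomialMap Φ)
    (hne : (projImage Φ).Nonempty) :
    Algebra.trdeg ℂ (MvPolynomial (Module.Dual ℂ W) ℂ ⧸ coneIdeal (projImage Φ)) ≤
      (Nat.card κ + 1 : ℕ) := by
  choose f hf using hΦ.coneMap
  set θ : MvPolynomial (Module.Dual ℂ W) ℂ →ₐ[ℂ] MvPolynomial (Option κ) ℂ := aeval f with hθ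
  have hev : ∀ p u, eval u (θ p) = evalAt (coneMap Φ u) p := by
    intro p u
    rw [evalAt, ← funext fun φ => hf φ u, hθ, eval_aeval_eq]
  have hker : ∀ p, p ∈ coneIdeal (projImage Φ) ↔ θ p = 0 := by
    intro p
    constructor
    · intro hp
      refine MvPolynomial.funext fun u => ?_
      rw [hev, map_zero]
      by_cases h0 : coneMap Φ u = 0
      · rw [h0]
        exact (coneIdeal_lt_irrelevantIdeal hne).le hp
      · have hu : Φ (fun i => u (some i)) ≠ 0 := right_ne_zero_of_smul h0
        exact hp _ h0 ⟨_, hu, mk_smul_eq _ hu _ h0⟩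
    · rintro hp v hv ⟨t, ht, hvt⟩
      obtain ⟨c, hc⟩ := (Projectivization.mk_eq_mk_iff' ℂ _ _ hv ht).1 hvt
      have := hev p (fun o => o.elim c t)
      have hcv : coneMap Φ (fun o => o.elim c t) = v := hc
      rwa [hp, map_zero, hcv, eq_comm] at this
  have h1 := lift_trdeg_quotient_le θ hker
  rw [trdeg_mvPolynomial_of_finite, Finite.card_option, lift_natCast, lift_le_nat_iff] at h1
  exact h1

theorem trdeg_quotient_le_of_le {k R : Type*} [Field k] [CommRing R] [Algebra k R] {p q : Ideal R}
    (hpq : p ≤ q) : Algebra.trdeg k (R ⧸ q) ≤ Algebra.trdeg k (R ⧸ p) :=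
  trdeg_le_of_surjective (Ideal.Quotient.factorₐ k hpq)
    (Ideal.Quotient.factor_surjective hpq)

/-- The length of a chain is bounded by the transcendence degree of its largest member. The
irrelevant ideal lies above all the ideals of the chain, which accounts for the shift by one between
the projective dimension and the transcendence degree on the cone. -/
theorem length_le_of_trdeg_coneIdeal_le (l : LTSeries (IrreducibleCloseds (ℙ ℂ W))) {n : ℕ}
    (hl : Algebra.trdeg ℂ (MvPolynomial (Module.Dual ℂ W) ℂ ⧸
      coneIdeal (l.last : Set (ℙ ℂ W))) ≤ (n + 1 : ℕ)) : l.length ≤ n := by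
  have hfin : ∀ i, Algebra.trdeg ℂ (MvPolynomial (Module.Dual ℂ W) ℂ ⧸
      coneIdeal (l i : Set (ℙ ℂ W))) < ℵ₀ := fun i =>
    ((trdeg_quotient_le_of_le (by
      rw [← closure_subset_closure_iff, (l i).isClosed.closure_eq, l.last.isClosed.closure_eq]
      exact LTSeries.monotone l (Fin.le_last i))).trans hl).trans_lt (natCast_lt_aleph0)
  have hlow : ∀ i (hi : i < l.length + 1), ((i + 1 : ℕ) : Cardinal) ≤
      Algebra.trdeg ℂ (MvPolynomial (Module.Dual ℂ W) ℂ ⧸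
        coneIdeal (l ⟨i, hi⟩ : Set (ℙ ℂ W))) := by
    intro i
    induction i with
    | zero =>
      intro hi
      have := coneIdeal_isPrime (l ⟨0, hi⟩).isIrreducible
      have h := trdeg_quotient_lt (coneIdeal_lt_irrelevantIdeal (l ⟨0, hi⟩).isIrreducible.nonempty)
        (hfin _)
      rw [zero_add, Nat.cast_one, Cardinal.one_le_iff_pos]
      exact zero_le.trans_lt h
    | succ i ih =>
      intro hi
      have h1 := ih (by omega)
      have := coneIdeal_isPrime (l ⟨i, by omega⟩).isIrreducible
      have := coneIdeal_isPrime (l ⟨i + 1, hi⟩).isIrreducible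
      have hlt : l ⟨i, by omega⟩ < l ⟨i + 1, hi⟩ :=
        LTSeries.strictMono l (Fin.mk_lt_mk.2 (Nat.lt_succ_self i))
      have h2 := trdeg_quotient_lt (k := ℂ) (coneIdeal_strictAnti_of_isClosed
        (IrreducibleCloseds.isClosed _) (IrreducibleCloseds.isClosed _) hlt) (hfin _)
      rw [Nat.cast_add, Nat.cast_one, Cardinal.natCast_add_one_le_iff]
      exact h1.trans_lt h2
  have h := (hlow l.length (by omega)).trans hl
  have := Nat.cast_le.1 h
  omega

/-- A set covered, up to closure, by finitely many polynomially parametrized pieces has dimension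
at most the number of parameters. -/
theorem zariskiDim_le_of_subset_closure [Finite κ] {α : Type*} [Finite α]
    {Φ : α → (κ → ℂ) → W} (hΦ : ∀ a, IsPolynomialMap (Φ a)) {X : Set (ℙ ℂ W)}
    (hX : X ⊆ closure (⋃ a, projImage (Φ a))) :
    zariskiDim X ≤ (Nat.card κ : WithBot ℕ∞) := by
  refine iSup_le fun l => ?_
  let l' : LTSeries (IrreducibleCloseds (ℙ ℂ W)) :=
    l.map _ (IrreducibleCloseds.map_strictMono_of_isInducing Topology.IsInducing.subtypeVal)
  suffices l'.length ≤ Nat.card κ from Nat.cast_le.2 this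
  have hsub : (l'.last : Set (ℙ ℂ W)) ⊆ ⋃ a, closure (projImage (Φ a)) := by
    rw [← closure_iUnion_of_finite]
    refine closure_minimal ?_ isClosed_closure
    rintro _ ⟨x, -, rfl⟩
    exact hX x.2
  obtain ⟨a, ha⟩ : ∃ a, (l'.last : Set (ℙ ℂ W)) ⊆ closure (projImage (Φ a)) := by
    classical
    have := Fintype.ofFinite α
    obtain ⟨z, hz, hlz⟩ := isIrreducible_iff_sUnion_isClosed.1 l'.last.isIrreducible
      (Finset.univ.image fun a => closure (projImage (Φ a)))
      (by simp) (by simpa using hsub)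
    obtain ⟨a, -, rfl⟩ := Finset.mem_image.1 hz
    exact ⟨a, hlz⟩
  have hne : (projImage (Φ a)).Nonempty :=
    closure_nonempty_iff.1 (l'.last.isIrreducible.nonempty.mono ha)
  refine length_le_of_trdeg_coneIdeal_le l'
    ((trdeg_quotient_le_of_le ?_).trans (trdeg_coneIdeal_projImage_le (hΦ a) hne))
  rw [← closure_subset_closure_iff, l'.last.isClosed.closure_eq]
  exact ha

/-! ### Immersive parametrizations -/

/-- The linear forms `φ none` and `φ (some i)` exhibit the polynomial map `Φ` as immersive, in the
projective sense, at the origin: the derivatives at `(1, 0)` of their values on the cone over `Φ`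
form the identity matrix. -/
def IsImmersiveAtZero [Fintype κ] [DecidableEq κ] (Φ : (κ → ℂ) → W)
    (φ : Option κ → Module.Dual ℂ W) : Prop :=
  (∀ o, φ o (Φ 0) = if o = none then 1 else 0) ∧
    ∀ o, HasStrictFDerivAt (fun t => φ o (Φ t))
      (o.elim 0 fun i => ContinuousLinearMap.proj i : (κ → ℂ) →L[ℂ] ℂ) 0

variable [Fintype κ] [DecidableEq κ]

theorem IsImmersiveAtZero.ne_zero {Φ : (κ → ℂ) → W} {φ : Option κ → Module.Dual ℂ W}
    (h : IsImmersiveAtZero Φ φ) : Φ 0 ≠ 0 := fun h0 => by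
  have := h.1 none
  rw [h0, map_zero] at this
  simp at this

/-- The linear forms of an immersive map are algebraically independent on the cone over its image:
by the inverse function theorem they take all values near a point. -/
theorem IsImmersiveAtZero.le_trdeg {Φ : (κ → ℂ) → W} {φ : Option κ → Module.Dual ℂ W}
    (h : IsImmersiveAtZero Φ φ) :
    ((Fintype.card κ + 1 : ℕ) : Cardinal) ≤
      Algebra.trdeg ℂ (MvPolynomial (Module.Dual ℂ W) ℂ ⧸ coneIdeal (projImage Φ)) := by
  let u₀ : Option κ → ℂ := fun o => if o = none then 1 else 0
  let G : (Option κ → ℂ) → Option κ → ℂ := fun u o => φ o (coneMap Φ u)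
  have hG : HasStrictFDerivAt G (ContinuousLinearMap.id ℂ (Option κ → ℂ)) u₀ := by
    refine hasStrictFDerivAt_pi'.2 fun o => ?_
    let S : (Option κ → ℂ) →L[ℂ] (κ → ℂ) :=
      ContinuousLinearMap.pi fun i => ContinuousLinearMap.proj (some i)
    have hS : S u₀ = 0 := by
      funext i
      simp [S, u₀]
    have h1 : HasStrictFDerivAt (fun u => φ o (Φ (S u))) _ u₀ :=
      HasStrictFDerivAt.comp (g := fun t => φ o (Φ t)) u₀ (by rw [hS]; exact h.2 o)
        S.hasStrictFDerivAt
    have h2 := (ContinuousLinearMap.proj (R := ℂ) (φ := fun _ : Option κ => ℂ)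
      none).hasStrictFDerivAt (x := u₀) |>.mul h1
    have h3 : (fun u => G u o) = fun u => (ContinuousLinearMap.proj (R := ℂ)
        (φ := fun _ : Option κ => ℂ) none) u * φ o (Φ (S u)) := by
      funext u
      simp only [G, coneMap, map_smul, smul_eq_mul]
      rfl
    rw [h3]
    refine h2.congr_fderiv ?_
    ext u
    rw [hS, h.1 o]
    cases o <;> simp [u₀, S]
  have hnhds := hG.map_nhds_eq_of_surj (LinearMap.range_id)
  have hind : AlgebraicIndependent ℂ fun o : Option κ =>
      Ideal.Quotient.mkₐ ℂ (coneIdeal (projImage Φ)) (X (φ o)) := by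
    rw [algebraicIndependent_iff]
    intro P hP
    have hmem : aeval (fun o => (X (φ o) : MvPolynomial (Module.Dual ℂ W) ℂ)) P ∈
        coneIdeal (projImage Φ) := by
      rw [← Ideal.Quotient.eq_zero_iff_mem, ← hP]
      exact MvPolynomial.comp_aeval_apply (fun o => (X (φ o) : MvPolynomial (Module.Dual ℂ W) ℂ))
        (Ideal.Quotient.mkₐ ℂ (coneIdeal (projImage Φ))) P
    have hval : ∀ v : W, evalAt v (aeval (fun o => (X (φ o) : MvPolynomial _ ℂ)) P) =
        eval (fun o => φ o v) P := by
      intro v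
      rw [evalAt, eval_aeval_eq]
      simp only [MvPolynomial.eval_X]
    have hcont : ContinuousAt G u₀ := hG.continuousAt
    have hG0 : G u₀ none = 1 := by
      have := h.1 none
      have hu : coneMap Φ u₀ = Φ 0 := by
        simp only [coneMap, u₀, if_true, one_smul, reduceCtorEq, if_false]
        rfl
      simpa only [G, hu, if_true] using this
    -- near `u₀` the vector `coneMap Φ u` is nonzero, so `P` vanishes at `G u`
    have hev : ∀ᶠ y in nhds (G u₀), eval y P = 0 := by
      rw [← hnhds, Filter.eventually_map]
      have hne : ∀ᶠ u in nhds u₀, G u none ≠ 0 :=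
        ((continuous_apply none).continuousAt.comp hcont).eventually_ne
          (by rw [Function.comp_apply, hG0]; exact one_ne_zero)
      filter_upwards [hne] with u hu
      have hc : coneMap Φ u ≠ 0 := fun h0 => hu (by simp only [G, h0, map_zero])
      have hu' : Φ (fun i => u (some i)) ≠ 0 := right_ne_zero_of_smul hc
      have := hmem _ hc ⟨_, hu', mk_smul_eq _ hu' _ hc⟩
      rwa [hval] at this
    obtain ⟨ε, hε, hball⟩ := Metric.eventually_nhds_iff_ball.1 hev
    refine MvPolynomial.funext_set (fun o => Metric.ball (G u₀ o) ε) (fun o => ?_) fun y hy => ?_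
    · exact infinite_of_mem_nhds (G u₀ o) (Metric.ball_mem_nhds _ hε)
    · rw [map_zero]
      refine hball y ?_
      rw [ball_pi _ hε]
      exact hy
  have := hind.lift_cardinalMk_le_trdeg
  rw [Cardinal.mk_fintype, Fintype.card_option] at this
  simpa using this

end PolynomialMaps

/-! ### The dimension of an immersively parametrized set -/

section LowerBound

variable {W : Type*} [AddCommGroup W] [Module ℂ W] {n : ℕ}

/-- The inclusion of `ℂ^k` into `ℂ^n` as the subspace of the first `k` coordinates. -/
def extendByZero (n k : ℕ) (t : Fin k → ℂ) (i : Fin n) : ℂ :=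
  if h : (i : ℕ) < k then t ⟨i, h⟩ else 0

theorem IsPolynomialMap.comp_extendByZero {Φ : (Fin n → ℂ) → W} (hΦ : IsPolynomialMap Φ) (k : ℕ) :
    IsPolynomialMap fun t => Φ (extendByZero n k t) := by
  intro φ
  obtain ⟨p, hp⟩ := hΦ φ
  refine ⟨aeval (fun i : Fin n => if h : (i : ℕ) < k then X ⟨i, h⟩ else 0) p, fun t => ?_⟩
  rw [← hp, eval_aeval_eq]
  have : (fun i : Fin n => eval t (if h : (i : ℕ) < k then X ⟨i, h⟩ else 0)) =
      extendByZero n k t := by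
    funext i
    unfold extendByZero
    split_ifs <;> simp
  rw [this]

theorem IsImmersiveAtZero.comp_extendByZero {Φ : (Fin n → ℂ) → W}
    {φ : Option (Fin n) → Module.Dual ℂ W} (h : IsImmersiveAtZero Φ φ) {k : ℕ} (hk : k ≤ n) :
    IsImmersiveAtZero (fun t => Φ (extendByZero n k t)) fun o => φ (o.map (Fin.castLE hk)) := by
  let S : (Fin k → ℂ) →L[ℂ] (Fin n → ℂ) := ContinuousLinearMap.pi fun i =>
    if h : (i : ℕ) < k then ContinuousLinearMap.proj ⟨i, h⟩ else 0
  have hS : ∀ t, extendByZero n k t = S t := by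
    intro t
    funext i
    simp only [extendByZero, S, ContinuousLinearMap.coe_pi']
    split_ifs <;> rfl
  simp only [IsImmersiveAtZero, hS]
  refine ⟨fun o => ?_, fun o => ?_⟩
  · rw [map_zero, h.1]
    cases o <;> simp
  · have h1 := HasStrictFDerivAt.comp (g := fun t => φ (o.map (Fin.castLE hk)) (Φ t)) (f := S) 0
      (by rw [map_zero]; exact h.2 _) S.hasStrictFDerivAt
    refine h1.congr_fderiv ?_
    ext t
    cases o <;> simp [S]

theorem le_zariskiDim_of_projImage_subset_fin {Φ : (Fin n → ℂ) → W} (hΦ : IsPolynomialMap Φ)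
    {φ : Option (Fin n) → Module.Dual ℂ W} (h : IsImmersiveAtZero Φ φ) {X : Set (ℙ ℂ W)}
    (hX : projImage Φ ⊆ X) : (n : WithBot ℕ∞) ≤ zariskiDim X := by
  let Y : ℕ → Set (ℙ ℂ W) := fun k => projImage fun t => Φ (extendByZero n k t)
  have hYX : ∀ k, Y k ⊆ X := by
    rintro k _ ⟨t, ht, rfl⟩
    exact hX ⟨_, ht, rfl⟩
  have hYmono : ∀ k, Y k ⊆ Y (k + 1) := by
    rintro k _ ⟨t, ht, rfl⟩
    have : extendByZero n (k + 1) (extendByZero (k + 1) k t) = extendByZero n k t := by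
      funext i
      unfold extendByZero
      by_cases h1 : (i : ℕ) < k
      · simp [h1, h1.trans (Nat.lt_succ_self k)]
      · simp [h1]
    refine ⟨extendByZero (k + 1) k t, by simpa only [this] using ht, ?_⟩
    simp only [this]
  have hYne : ∀ k, k ≤ n → (Y k).Nonempty := fun k hk =>
    ⟨_, 0, (h.comp_extendByZero hk).ne_zero, rfl⟩
  have hYtr : ∀ k, k ≤ n → Algebra.trdeg ℂ (MvPolynomial (Module.Dual ℂ W) ℂ ⧸ coneIdeal (Y k)) =
      (k + 1 : ℕ) := by
    intro k hk
    apply le_antisymm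
    · simpa using trdeg_coneIdeal_projImage_le (hΦ.comp_extendByZero k) (hYne k hk)
    · simpa using (h.comp_extendByZero hk).le_trdeg
  have hYirr : ∀ k, k ≤ n → IsIrreducible (((↑) : X → ℙ ℂ W) ⁻¹' Y k) := by
    intro k hk
    have := isIrreducible_projImage (hΦ.comp_extendByZero k) (hYne k hk)
    refine ⟨?_, ?_⟩
    · obtain ⟨x, hx⟩ := hYne k hk
      exact ⟨⟨x, hYX k hx⟩, hx⟩
    · rintro _ _ ⟨U, hU, rfl⟩ ⟨V, hV, rfl⟩ ⟨x, hx, hxU⟩ ⟨y, hy, hyV⟩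
      obtain ⟨z, hz, hzU, hzV⟩ := this.isPreirreducible U V hU hV ⟨x, hx, hxU⟩ ⟨y, hy, hyV⟩
      exact ⟨⟨z, hYX k hz⟩, hz, hzU, hzV⟩
  let C : Fin (n + 1) → IrreducibleCloseds X := fun k =>
    ⟨closure (((↑) : X → ℙ ℂ W) ⁻¹' Y k), (hYirr k (by omega)).closure, isClosed_closure⟩
  have hC : StrictMono C := by
    refine Fin.strictMono_iff_lt_succ.2 fun k => lt_of_le_of_ne ?_ ?_
    · exact closure_mono (Set.preimage_mono (hYmono k))
    · intro heq
      have h1 : closure (((↑) : X → ℙ ℂ W) ⁻¹' Y k) = closure (((↑) : X → ℙ ℂ W) ⁻¹' Y (k + 1)) :=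
        congrArg (fun c : IrreducibleCloseds X => (c : Set X)) heq
      have h2 : closure (Y (k + 1)) ⊆ closure (Y k) := by
        refine closure_minimal (fun x hx => ?_) isClosed_closure
        have hx' : (⟨x, hYX _ hx⟩ : X) ∈ closure (((↑) : X → ℙ ℂ W) ⁻¹' Y k) := by
          rw [h1]
          exact subset_closure hx
        rw [closure_subtype] at hx'
        exact closure_mono (Set.image_preimage_subset _ _) hx'
      have h3 := trdeg_quotient_le_of_le (k := ℂ) (closure_subset_closure_iff.1 h2)
      rw [hYtr k (by omega), hYtr (k + 1) (by omega), Nat.cast_le] at h3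
      omega
  exact Order.LTSeries.length_le_krullDim (LTSeries.mk n C hC)

/-- A set containing the image of an immersive polynomial map has dimension at least the number
of parameters: the coordinate subspaces of the parameter space give a chain. -/
theorem le_zariskiDim_of_projImage_subset {κ : Type*} [Fintype κ] [DecidableEq κ]
    {Φ : (κ → ℂ) → W} (hΦ : IsPolynomialMap Φ) {φ : Option κ → Module.Dual ℂ W}
    (h : IsImmersiveAtZero Φ φ) {X : Set (ℙ ℂ W)} (hX : projImage Φ ⊆ X) :
    (Fintype.card κ : WithBot ℕ∞) ≤ zariskiDim X := by
  let e := Fintype.equivFin κ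
  let S : (Fin (Fintype.card κ) → ℂ) →L[ℂ] (κ → ℂ) :=
    ContinuousLinearMap.pi fun i => ContinuousLinearMap.proj (e i)
  refine le_zariskiDim_of_projImage_subset_fin (Φ := fun t => Φ (S t))
    (φ := fun o => φ (o.map e.symm)) (fun ψ => ?_) ⟨fun o => ?_, fun o => ?_⟩ ?_
  · obtain ⟨p, hp⟩ := hΦ ψ
    exact ⟨rename e p, fun t => by rw [eval_rename, ← hp]; rfl⟩
  · simp only [map_zero, h.1]
    cases o <;> simp
  · have h1 := HasStrictFDerivAt.comp (g := fun t => φ (o.map e.symm) (Φ t)) (f := S) 0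
      (by rw [map_zero]; exact h.2 _) S.hasStrictFDerivAt
    refine h1.congr_fderiv ?_
    ext t
    cases o <;> simp [S]
  · rintro _ ⟨t, ht, rfl⟩
    exact hX ⟨S t, ht, rfl⟩

end LowerBound

end ZariskiDimension

open CliffordAlgebra QuadraticMap

/-! ### Isotropic subspaces -/

section Isotropic

variable {V : Type*} [AddCommGroup V] [Module ℂ V] {Q : QuadraticForm ℂ V} {W : Submodule ℂ V}

theorem IsTotallyIsotropic.polar_eq_zero (hW : IsTotallyIsotropic Q W) {v w : V} (hv : v ∈ W)
    (hw : w ∈ W) : polar Q v w = 0 := by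
  rw [polar, hW _ (W.add_mem hv hw), hW v hv, hW w hw, sub_zero, sub_zero]

theorem eq_zero_of_forall_polar_eq_zero
    (hQ : LinearMap.BilinForm.Nondegenerate (associated (R := ℂ) Q)) {v : V}
    (hv : ∀ w, polar Q v w = 0) : v = 0 := by
  refine hQ.1 v fun w => ?_
  rw [associated_apply, ← polar, hv, smul_zero]

theorem ι_mul_list_prod_eq_zero (hW : IsTotallyIsotropic Q W) {l : List V} (hl : ∀ v ∈ l, v ∈ W)
    {w : V} (hw : w ∈ l) : ι Q w * (l.map (ι Q)).prod = 0 := by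
  induction l with
  | nil => simp at hw
  | cons v l ih =>
    rw [List.map_cons, List.prod_cons, ← mul_assoc]
    have hv := hl v (by simp)
    rcases List.mem_cons.1 hw with rfl | hw'
    · rw [ι_sq_scalar, hW w hv, map_zero, zero_mul]
    · have h := ι_mul_ι_add_swap (Q := Q) w v
      rw [hW.polar_eq_zero (hl w hw) hv, map_zero, add_eq_zero_iff_eq_neg] at h
      rw [h, neg_mul, mul_assoc, ih (fun u hu => hl u (List.mem_cons_of_mem _ hu)) hw', mul_zero,
        neg_zero]

theorem list_prod_mul_ι_eq_zero (hW : IsTotallyIsotropic Q W) {l : List V} (hl : ∀ v ∈ l, v ∈ W)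
    {w : V} (hw : w ∈ l) : (l.map (ι Q)).prod * ι Q w = 0 := by
  apply reverse_involutive.injective
  rw [reverse.map_mul, reverse_ι, reverse_prod_map_ι, ← List.map_reverse, map_zero]
  exact ι_mul_list_prod_eq_zero hW (by simpa using hl) (by simpa using hw)

theorem isBasisProduct_iff {f : CliffordAlgebra Q} : IsBasisProduct Q W f ↔
    ∃ (n : ℕ) (b : Module.Basis (Fin n) ℂ W),
      f = (((List.finRange n).map fun i => (b i : V)).map (ι Q)).prod := by
  simp only [IsBasisProduct, List.map_map, List.ofFn_eq_map]
  rfl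

theorem IsBasisProduct.ι_mul_eq_zero (hW : IsTotallyIsotropic Q W) {f : CliffordAlgebra Q}
    (hf : IsBasisProduct Q W f) {w : V} (hw : w ∈ W) : ι Q w * f = 0 := by
  obtain ⟨n, b, rfl⟩ := isBasisProduct_iff.1 hf
  have hsum : w = ∑ i, b.repr ⟨w, hw⟩ i • (b i : V) := by
    have := congrArg W.subtype (b.sum_repr ⟨w, hw⟩)
    rw [map_sum] at this
    exact this.symm
  rw [hsum, map_sum, Finset.sum_mul]
  refine Finset.sum_eq_zero fun i _ => ?_
  rw [map_smul, smul_mul_assoc, ι_mul_list_prod_eq_zero hW (by simp) (by simp), smul_zero]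

theorem IsBasisProduct.map {W : Submodule ℂ V} {n : ℕ} (b : Module.Basis (Fin n) ℂ W)
    (g : V ≃ₗ[ℂ] V) : IsBasisProduct Q (W.map (g : V →ₗ[ℂ] V))
      (((List.finRange n).map fun i => g (b i)).map (ι Q)).prod :=
  isBasisProduct_iff.2 ⟨n, b.map (g.submoduleMap W), rfl⟩

theorem IsMaximalTotallyIsotropic.map (hW : IsMaximalTotallyIsotropic Q W) (g : V ≃ₗ[ℂ] V)
    (hg : ∀ v, Q (g v) = Q v) : IsMaximalTotallyIsotropic Q (W.map (g : V →ₗ[ℂ] V)) := by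
  refine ⟨?_, fun U hU hWU => ?_⟩
  · rintro _ ⟨w, hw, rfl⟩
    exact (hg w).trans (hW.1 w hw)
  · have h1 : IsTotallyIsotropic Q (U.comap (g : V →ₗ[ℂ] V)) := fun v hv =>
      (hg v).symm.trans (hU _ hv)
    have h2 := hW.2 h1 (Submodule.map_le_iff_le_comap.1 hWU)
    intro u hu
    exact ⟨g.symm u, h2 (by simpa using hu), by simp⟩

/-- Over `ℂ` a maximal totally isotropic subspace has half the dimension of the space, up to
rounding: otherwise its orthogonal complement is larger by at least two dimensions and contains a
further isotropic vector. -/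
theorem IsMaximalTotallyIsotropic.finrank_le [FiniteDimensional ℂ V]
    (hW : IsMaximalTotallyIsotropic Q W) : Module.finrank ℂ V ≤ 2 * Module.finrank ℂ W + 1 := by
  by_contra! hlt
  let r : V →ₗ[ℂ] Module.Dual ℂ W := (W.subtype.dualMap).comp Q.polarBilin
  have hr : ∀ v w : V, ∀ hw : w ∈ W, r v ⟨w, hw⟩ = polar Q v w := fun v w hw => rfl
  have hWr : W ≤ LinearMap.ker r := by
    intro w hw
    rw [LinearMap.mem_ker]
    ext ⟨u, hu⟩
    rw [hr]
    exact hW.1.polar_eq_zero hw hu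
  have hrank := r.finrank_range_add_finrank_ker
  have hrange : Module.finrank ℂ (LinearMap.range r) ≤ Module.finrank ℂ W :=
    (Submodule.finrank_le _).trans (Subspace.dual_finrank_eq).le
  -- an isotropic vector orthogonal to `W` lies in `W`
  have key : ∀ v ∈ LinearMap.ker r, Q v = 0 → v ∈ W := by
    intro v hv hv0
    have hvw : ∀ w ∈ W, polar Q v w = 0 := fun w hw => by
      rw [← hr v w hw, LinearMap.mem_ker.1 hv]; rfl
    have hiso : IsTotallyIsotropic Q (W ⊔ Submodule.span ℂ {v}) := by
      intro x hx
      obtain ⟨w, hw, y, hy, rfl⟩ := Submodule.mem_sup.1 hx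
      obtain ⟨c, rfl⟩ := Submodule.mem_span_singleton.1 hy
      rw [QuadraticMap.map_add Q, hW.1 w hw, QuadraticMap.map_smul, hv0,
        polar_smul_right, polar_comm, hvw w hw]
      simp
    exact hW.2 hiso le_sup_left (Submodule.mem_sup_right (Submodule.mem_span_singleton_self v))
  -- two vectors of the orthogonal complement that are independent modulo `W`
  obtain ⟨x, hx, hxW⟩ : ∃ x ∈ LinearMap.ker r, x ∉ W := by
    by_contra! h
    have := Submodule.finrank_mono (R := ℂ) (show LinearMap.ker r ≤ W from h)
    omega
  obtain ⟨y, hy, hyW⟩ : ∃ y ∈ LinearMap.ker r, y ∉ W ⊔ Submodule.span ℂ {x} := by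
    by_contra! h
    have h1 := Submodule.finrank_mono (R := ℂ)
      (show LinearMap.ker r ≤ W ⊔ Submodule.span ℂ {x} from h)
    have h2 := Submodule.finrank_add_le_finrank_add_finrank W (Submodule.span ℂ {x})
    have h3 := finrank_span_singleton (K := ℂ) (v := x) (by rintro rfl; exact hxW W.zero_mem)
    omega
  have hQx : Q x ≠ 0 := fun h => hxW (key x hx h)
  obtain ⟨c, hc⟩ := exists_quadratic_eq_zero (K := ℂ) (a := Q x) (b := polar Q x y)
    (c := Q y) hQx ⟨_, (IsAlgClosed.exists_pow_nat_eq _ two_pos).choose_spec.symm.trans (sq _)⟩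
  refine hyW ?_
  have hmem : c • x + y ∈ W := by
    refine key _ (Submodule.add_mem _ (Submodule.smul_mem _ _ hx) hy) ?_
    rw [QuadraticMap.map_add Q, QuadraticMap.map_smul, polar_smul_left]
    simp only [smul_eq_mul]
    linear_combination hc
  have : y = (c • x + y) + (-c) • x := by simp
  rw [this]
  exact Submodule.add_mem_sup hmem (Submodule.smul_mem _ _ (Submodule.mem_span_singleton_self x))

end Isotropic

/-! ### The spin representation -/

/-- Dual bases of two complementary totally isotropic subspaces. -/
structure DualFrame {V : Type*} [AddCommGroup V] [Module ℂ V] (Q : QuadraticForm ℂ V)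
    (E F : Submodule ℂ V) (h : ℕ) where
  isotropicE : IsTotallyIsotropic Q E
  isotropicF : IsTotallyIsotropic Q F
  isCompl : IsCompl E F
  /-- The basis of `E`. -/
  e : Module.Basis (Fin h) ℂ E
  /-- The dual basis of `F`. -/
  f : Module.Basis (Fin h) ℂ F
  polar_f_e : ∀ i j, polar Q (f i : V) (e j) = if i = j then 1 else 0

section Frame

variable {V : Type*} [AddCommGroup V] [Module ℂ V] {Q : QuadraticForm ℂ V} {E F : Submodule ℂ V}

theorem exists_dualFrame {h : ℕ} [FiniteDimensional ℂ V] (hV : Module.finrank ℂ V = 2 * h)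
    (hQ : LinearMap.BilinForm.Nondegenerate (associated (R := ℂ) Q))
    (hE : IsTotallyIsotropic Q E) (hF : IsTotallyIsotropic Q F) (hEF : IsCompl E F) :
    Nonempty (DualFrame Q E F h) := by
  have hinj : ∀ {A B : Submodule ℂ V}, IsTotallyIsotropic Q A → IsCompl A B →
      Function.Injective ((B.subtype.dualMap).comp (Q.polarBilin.comp A.subtype)) := by
    intro A B hA hAB
    rw [← LinearMap.ker_eq_bot, LinearMap.ker_eq_bot']
    rintro ⟨a, ha⟩ h0
    have h1 : ∀ b ∈ B, polar Q a b = 0 := fun b hb => LinearMap.congr_fun h0 ⟨b, hb⟩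
    have : a = 0 := by
      refine eq_zero_of_forall_polar_eq_zero hQ fun w => ?_
      obtain ⟨x, hx, y, hy, rfl⟩ := Submodule.mem_sup.1
        (show w ∈ A ⊔ B by rw [hAB.sup_eq_top]; trivial)
      rw [polar_add_right, hA.polar_eq_zero ha hx, h1 y hy, add_zero]
    simpa using this
  have h1 := LinearMap.finrank_le_finrank_of_injective (hinj hE hEF)
  have h2 := LinearMap.finrank_le_finrank_of_injective (hinj hF hEF.symm)
  rw [Subspace.dual_finrank_eq] at h1 h2
  have h3 := Submodule.finrank_add_eq_of_isCompl hEF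
  have hE' : Module.finrank ℂ E = h := by omega
  let e := Module.finBasisOfFinrankEq ℂ E hE'
  let Θ : F ≃ₗ[ℂ] Module.Dual ℂ E := LinearEquiv.ofInjectiveOfFinrankEq _ (hinj hF hEF.symm)
    (by rw [Subspace.dual_finrank_eq]; omega)
  refine ⟨⟨hE, hF, hEF, e, e.dualBasis.map Θ.symm, fun i j => ?_⟩⟩
  have h4 : ∀ (x : F) (y : E), polar Q (x : V) y = Θ x y := fun x y => rfl
  rw [h4, Module.Basis.map_apply, LinearEquiv.apply_symm_apply, Module.Basis.dualBasis_apply,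
    Module.Basis.repr_self, Finsupp.single_apply]
  simp only [eq_comm]

namespace DualFrame

variable {h : ℕ} (S : DualFrame Q E F h)

variable (Q E) in
/-- The linear form `x ↦ B(v, x)` on `E`, where `B` is the polar form of `Q`. -/
def pairing : V →ₗ[ℂ] Module.Dual ℂ E := (E.subtype.dualMap).comp Q.polarBilin

include S in
theorem Q_eq_zero (x : E) : (Q.comp E.subtype) x = 0 := S.isotropicE x x.2

theorem pairing_apply (v : V) (x : E) : pairing Q E v x = polar Q v x := rfl

/-- The action of the vectors of `V` on spinors: vectors of `E` multiply, vectors of `F`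
contract. -/
def vectorAct : V →ₗ[ℂ] Module.End ℂ (Spinors Q E) :=
  (LinearMap.mul ℂ (Spinors Q E)).comp ((ι _).comp (E.projectionOnto F S.isCompl)) +
    LinearMap.comp CliffordAlgebra.contractLeft (pairing Q E)

theorem vectorAct_apply (v : V) (x : Spinors Q E) :
    S.vectorAct v x = ι _ (E.projectionOnto F S.isCompl v) * x +
      contractLeft (pairing Q E v) x := rfl

theorem eq_proj_add (v : V) : ∃ u : F, v = (E.projectionOnto F S.isCompl v : V) + u := by
  refine ⟨⟨v - E.projectionOnto F S.isCompl v, ?_⟩, by simp⟩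
  have := Submodule.sub_projection_mem S.isCompl v
  rwa [Submodule.projection_apply] at this

theorem vectorAct_mul_self (v : V) :
    S.vectorAct v * S.vectorAct v = algebraMap ℂ (Module.End ℂ (Spinors Q E)) (Q v) := by
  ext x
  obtain ⟨u, hu⟩ := S.eq_proj_add v
  set p := E.projectionOnto F S.isCompl v
  have hQv : pairing Q E v p = Q v := by
    rw [pairing_apply]
    conv_lhs => rw [hu]
    conv_rhs => rw [hu]
    rw [polar_add_left, S.isotropicE.polar_eq_zero p.2 p.2, zero_add,
      QuadraticMap.map_add Q, S.isotropicE _ p.2, S.isotropicF _ u.2, polar_comm]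
    ring
  rw [Module.End.mul_apply, vectorAct_apply, vectorAct_apply, map_add, contractLeft_ι_mul,
    contractLeft_contractLeft, mul_add, ← mul_assoc, ι_sq_scalar, S.Q_eq_zero, hQv]
  simp

/-- The spin representation of the Clifford algebra on the space of spinors. -/
def act : CliffordAlgebra Q →ₐ[ℂ] Module.End ℂ (Spinors Q E) :=
  CliffordAlgebra.lift Q ⟨S.vectorAct, S.vectorAct_mul_self⟩

theorem act_ι (v : V) (x : Spinors Q E) :
    S.act (ι Q v) x = ι _ (E.projectionOnto F S.isCompl v) * x +
      contractLeft (pairing Q E v) x := by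
  rw [act, lift_ι_apply, vectorAct_apply]

theorem act_mul (a b : CliffordAlgebra Q) (x : Spinors Q E) :
    S.act (a * b) x = S.act a (S.act b x) := by
  rw [map_mul, Module.End.mul_apply]

theorem act_ι_of_mem_E (v : E) (x : Spinors Q E) : S.act (ι Q (v : V)) x = ι _ v * x := by
  have : pairing Q E (v : V) = 0 := by
    ext x
    exact S.isotropicE.polar_eq_zero v.2 x.2
  rw [act_ι, this, map_zero, Submodule.projectionOnto_apply_left]
  simp

theorem act_ι_of_mem_F (v : F) (x : Spinors Q E) :
    S.act (ι Q (v : V)) x = contractLeft (pairing Q E (v : V)) x := by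
  rw [act_ι, Submodule.projectionOnto_apply_right, map_zero, zero_mul, zero_add]

theorem spinorsToClifford_ι (v : E) :
    spinorsToClifford Q E (ι _ v) = ι Q (v : V) := CliffordAlgebra.map_apply_ι _ _

theorem act_spinorsToClifford (s x : Spinors Q E) :
    S.act (spinorsToClifford Q E s) x = s * x := by
  have : S.act.comp (spinorsToClifford Q E) = Algebra.lmul ℂ (Spinors Q E) := by
    apply CliffordAlgebra.hom_ext
    ext v x
    simp only [LinearMap.comp_apply, AlgHom.toLinearMap_apply, AlgHom.comp_apply,
      spinorsToClifford_ι, act_ι_of_mem_E]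
    rfl
  exact LinearMap.congr_fun (DFunLike.congr_fun this s) x

/-- The augmentation of the algebra of spinors: the component of degree zero. -/
def aug : Spinors Q E →ₐ[ℂ] ℂ :=
  CliffordAlgebra.lift _ ⟨0, fun m => by simp [S.Q_eq_zero]⟩

theorem aug_ι (v : E) : S.aug (ι _ v) = 0 := by
  rw [aug, lift_ι_apply, LinearMap.zero_apply]

theorem aug_ι_mul (v : E) (x : Spinors Q E) : S.aug (ι _ v * x) = 0 := by
  rw [map_mul, aug_ι, zero_mul]

/-- If `f` is killed by left multiplication by `F`, then `s ↦ s f` intertwines the spin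
representation with left multiplication. -/
theorem spinorsToClifford_act_mul {f : CliffordAlgebra Q} (hf : ∀ v ∈ F, ι Q v * f = 0)
    (a : CliffordAlgebra Q) (s : Spinors Q E) :
    spinorsToClifford Q E (S.act a s) * f = a * (spinorsToClifford Q E s * f) := by
  induction a using CliffordAlgebra.induction generalizing s with
  | algebraMap r =>
    rw [AlgHom.commutes, Module.algebraMap_end_apply, map_smul, smul_mul_assoc, Algebra.smul_def]
  | mul a b ha hb => rw [act_mul, ha, hb, mul_assoc]
  | add a b ha hb => rw [map_add, LinearMap.add_apply, map_add, add_mul, ha, hb, add_mul]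
  | ι v =>
    have hF : ∀ (u : F) (s : Spinors Q E),
        spinorsToClifford Q E (contractLeft (pairing Q E (u : V)) s) * f =
          ι Q (u : V) * (spinorsToClifford Q E s * f) := by
      intro u s
      induction s using CliffordAlgebra.left_induction with
      | algebraMap r =>
        rw [contractLeft_algebraMap, map_zero, zero_mul, AlgHom.commutes, ← Algebra.smul_def,
          mul_smul_comm, hf _ u.2, smul_zero]
      | add x y hx hy => rw [map_add, map_add, map_add, add_mul, add_mul, mul_add, hx, hy]
      | ι_mul x m hx =>
        have hswap := ι_mul_ι_add_swap (Q := Q) (u : V) (m : V)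
        rw [contractLeft_ι_mul, map_sub, map_smul, map_mul, sub_mul, mul_assoc, hx, map_mul,
          spinorsToClifford_ι, pairing_apply, smul_mul_assoc, Algebra.smul_def, ← hswap]
        noncomm_ring
    obtain ⟨u, hu⟩ := S.eq_proj_add v
    rw [act_ι, map_add, map_mul, add_mul, spinorsToClifford_ι]
    have hp : pairing Q E v = pairing Q E (u : V) := by
      ext x
      rw [pairing_apply, pairing_apply, hu, polar_add_left,
        S.isotropicE.polar_eq_zero (Subtype.coe_prop _) x.2, zero_add]
    rw [hp, hF, mul_assoc, ← add_mul, ← map_add, ← hu]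

theorem contractLeft_list_prod_eq_zero (d : Module.Dual ℂ E) {l : List E} (hl : ∀ v ∈ l, d v = 0)
    {x : Spinors Q E} (hx : contractLeft d x = 0) :
    contractLeft d ((l.map (ι (Q.comp E.subtype))).prod * x) = 0 := by
  induction l with
  | nil => simpa using hx
  | cons v l ih =>
    rw [List.map_cons, List.prod_cons, mul_assoc, contractLeft_ι_mul, hl v (by simp), zero_smul,
      ih fun u hu => hl u (List.mem_cons_of_mem _ hu), mul_zero, sub_zero]

/-- Multiplying by a product of vectors of `E` and then contracting by the dual vectors in the
opposite order is the identity on spinors that these contractions kill. -/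
theorem act_reverse_prod_mul {n : ℕ} (b : Fin n → F) (c : Fin n → E)
    (hbc : ∀ i j, polar Q (b i : V) (c j) = if i = j then 1 else 0) {x : Spinors Q E}
    (hx : ∀ i, contractLeft (pairing Q E (b i : V)) x = 0) {r : List (Fin n)}
    (hr : r.Nodup) :
    S.act ((r.reverse.map fun i => (b i : V)).map (ι Q)).prod
      (((r.map c).map (ι _)).prod * x) = x := by
  induction r with
  | nil => simp
  | cons i r ih =>
    obtain ⟨hi, hr⟩ := List.nodup_cons.1 hr
    rw [List.reverse_cons, List.map_append, List.map_append, List.prod_append, act_mul]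
    simp only [List.map_cons, List.map_nil, List.prod_cons, List.prod_nil, mul_one]
    rw [act_ι_of_mem_F, mul_assoc, contractLeft_ι_mul, pairing_apply, hbc, if_pos rfl, one_smul,
      contractLeft_list_prod_eq_zero _ _ (hx i), mul_zero, sub_zero, ih hr]
    intro v hv
    obtain ⟨j, hj, rfl⟩ := List.mem_map.1 hv
    rw [pairing_apply, hbc, if_neg]
    rintro rfl
    exact hi hj

include S in
theorem exists_polar_eq (φ : Module.Dual ℂ F) : ∃ x : E, ∀ v : F, polar Q (v : V) x = φ v := by
  refine ⟨∑ i, φ (S.f i) • S.e i, fun v => ?_⟩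
  have : LinearMap.flip ((pairing Q E).comp F.subtype) (∑ i, φ (S.f i) • S.e i) = φ := by
    refine S.f.ext fun j => ?_
    rw [LinearMap.flip_apply, map_sum]
    simp only [map_smul, LinearMap.comp_apply, Submodule.subtype_apply, pairing_apply,
      S.polar_f_e, smul_eq_mul, mul_ite, mul_one, mul_zero]
    simp
  exact LinearMap.congr_fun this v

/-- The product of the vectors of a basis of `F` maps a suitable spinor to `1`. -/
theorem exists_act_eq_one {f : CliffordAlgebra Q} (hf : IsBasisProduct Q F f) :
    ∃ τ : Spinors Q E, S.act f τ = 1 := by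
  obtain ⟨n, b, rfl⟩ := isBasisProduct_iff.1 hf
  choose c hc using fun i => S.exists_polar_eq (b.coord i)
  have hbc : ∀ i j, polar Q (b i : V) (c j) = if i = j then 1 else 0 := fun i j => by
    rw [hc, Module.Basis.coord_apply, Module.Basis.repr_self, Finsupp.single_apply]
  have := S.act_reverse_prod_mul b c hbc (x := 1) (fun i => contractLeft_one _ _)
    (List.nodup_reverse.2 (List.nodup_finRange n))
  rw [List.reverse_reverse] at this
  exact ⟨_, this⟩

/-- A spinor killed by all contractions is a scalar. -/
theorem eq_aug_of_forall_act_f {x : Spinors Q E}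
    (hx : ∀ i, S.act (ι Q (S.f i : V)) x = 0) : x = algebraMap ℂ _ (S.aug x) := by
  have hx' : ∀ i, contractLeft (pairing Q E (S.f i : V)) x = 0 := fun i => by
    rw [← S.act_ι_of_mem_F, hx]
  have hnd := List.nodup_finRange h
  -- the product of the basis of `E` multiplies every spinor through the augmentation
  have htop : ∀ y : Spinors Q E, ((((List.finRange h).map S.e).map (ι _)).prod : Spinors Q E) * y =
      ((((List.finRange h).map S.e).map (ι _)).prod : Spinors Q E) *
        algebraMap ℂ _ (S.aug y) := by
    intro y
    induction y using CliffordAlgebra.left_induction with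
    | algebraMap r => rw [AlgHom.commutes]; rfl
    | add x y hx hy => rw [mul_add, hx, hy, map_add, map_add, mul_add]
    | ι_mul x m hx =>
      rw [aug_ι_mul, map_zero, mul_zero, ← mul_assoc]
      have : ((((List.finRange h).map S.e).map (ι _)).prod : Spinors Q E) * ι _ m = 0 := by
        have hm := S.e.sum_repr m
        rw [← hm, map_sum, Finset.mul_sum]
        refine Finset.sum_eq_zero fun i _ => ?_
        rw [map_smul, mul_smul_comm, list_prod_mul_ι_eq_zero (W := ⊤)
          (fun v _ => S.Q_eq_zero v) (by simp) (by simp), smul_zero]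
      rw [this, zero_mul]
  have h1 := S.act_reverse_prod_mul (fun i => S.f i) (fun i => S.e i) S.polar_f_e hx' hnd
  have h2 := S.act_reverse_prod_mul (fun i => S.f i) (fun i => S.e i) S.polar_f_e
    (x := algebraMap ℂ _ (S.aug x)) (fun i => contractLeft_algebraMap _ _ _) hnd
  rw [← h1]
  conv_rhs => rw [h1, ← h2]
  exact congrArg _ (htop x)

end DualFrame

end Frame

section PureSpinors

variable {V : Type*} [AddCommGroup V] [Module ℂ V] {Q : QuadraticForm ℂ V} {E F : Submodule ℂ V}

theorem IsPureSpinor.smul {s : Spinors Q E} (hs : IsPureSpinor Q E F s) {c : ℂ} (hc : c ≠ 0) :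
    IsPureSpinor Q E F (c • s) := by
  obtain ⟨W, hW, h0, f, fW, x, hf, hfW, hx⟩ := hs
  exact ⟨W, hW, smul_ne_zero hc h0, f, fW, c • x, hf, hfW, by
    rw [map_smul, smul_mul_assoc, hx, mul_smul_comm]⟩

namespace DualFrame

variable {h : ℕ} (S : DualFrame Q E F h)

/-! ### Transformations of pure spinors -/

/-- The subspace represented by a pure spinor annihilates it. -/
theorem act_eq_zero_of_isRepresentativeSpinor {W : Submodule ℂ V} (hW : IsTotallyIsotropic Q W)
    {s : Spinors Q E} (hs : IsRepresentativeSpinor Q E F W s) {w : V} (hw : w ∈ W) :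
    S.act (ι Q w) s = 0 := by
  obtain ⟨-, f, fW, x, hf, hfW, hx⟩ := hs
  obtain ⟨τ, hτ⟩ := S.exists_act_eq_one hf
  have h1 : s = S.act fW (S.act x τ) := by
    rw [← act_mul, ← hx, act_mul, hτ, act_spinorsToClifford, mul_one]
  rw [h1, ← act_mul, hfW.ι_mul_eq_zero hW hw, map_zero, LinearMap.zero_apply]

include S in
theorem isPureSpinor_one (hF : IsMaximalTotallyIsotropic Q F) :
    IsPureSpinor Q E F (1 : Spinors Q E) := by
  refine ⟨F, hF, fun h => ?_, _, _, 1, ⟨h, S.f, rfl⟩, ⟨h, S.f, rfl⟩, by simp⟩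
  have := congrArg S.aug h
  simp at this

theorem mul_list_prod_of_intertwines {a : CliffordAlgebra Q} {g : V ≃ₗ[ℂ] V}
    (hag : ∀ v, a * ι Q v = ι Q (g v) * a) (l : List V) :
    a * (l.map (ι Q)).prod = ((l.map g).map (ι Q)).prod * a := by
  induction l with
  | nil => simp
  | cons v l ih =>
    simp only [List.map_cons, List.prod_cons]
    rw [← mul_assoc, hag, mul_assoc, ih, mul_assoc]

/-- An element of the Clifford algebra that intertwines left and right multiplication by vectors
up to an isometry `g` maps the pure spinors of `W` to pure spinors of `g W`. -/
theorem isPureSpinor_act {a : CliffordAlgebra Q} {g : V ≃ₗ[ℂ] V} (hg : ∀ v, Q (g v) = Q v)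
    (hag : ∀ v, a * ι Q v = ι Q (g v) * a) {s : Spinors Q E} (hs : IsPureSpinor Q E F s)
    (h0 : S.act a s ≠ 0) : IsPureSpinor Q E F (S.act a s) := by
  obtain ⟨W, hW, -, f, fW, x, hf, hfW, hx⟩ := hs
  obtain ⟨n, b, rfl⟩ := isBasisProduct_iff.1 hfW
  refine ⟨_, hW.map g hg, h0, f, _, a * x, hf, IsBasisProduct.map b g, ?_⟩
  rw [S.spinorsToClifford_act_mul (fun v hv => hf.ι_mul_eq_zero S.isotropicF hv), hx,
    ← mul_assoc, mul_list_prod_of_intertwines hag, mul_assoc,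
    List.map_map (f := fun i => (b i : V))]
  rfl

/-- The reflection in a vector of square `1`, followed by `-1`, as a linear equivalence. -/
def negReflection {v : V} (hv : Q v = 1) : V ≃ₗ[ℂ] V :=
  have hinv : ∀ w, polar Q v (polar Q v w • v - w) • v - (polar Q v w • v - w) = w := fun w => by
    rw [polar_sub_right, polar_smul_right, polar_self, hv, sub_smul]
    simp only [smul_eq_mul]
    module
  { toFun := fun w => polar Q v w • v - w
    map_add' := fun w w' => by rw [polar_add_right]; module
    map_smul' := fun c w => by
      rw [polar_smul_right, RingHom.id_apply, smul_eq_mul]; module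
    invFun := fun w => polar Q v w • v - w
    left_inv := hinv
    right_inv := hinv }

theorem negReflection_apply {v : V} (hv : Q v = 1) (w : V) :
    negReflection hv w = polar Q v w • v - w := rfl

theorem Q_negReflection {v : V} (hv : Q v = 1) (w : V) : Q (negReflection hv w) = Q w := by
  rw [negReflection_apply, sub_eq_add_neg, QuadraticMap.map_add Q, QuadraticMap.map_smul,
    QuadraticMap.map_neg, hv, polar_neg_right, polar_smul_left]
  simp only [smul_eq_mul]
  ring

theorem ι_mul_ι_negReflection {v : V} (hv : Q v = 1) (w : V) :
    ι Q v * ι Q w = ι Q (negReflection hv w) * ι Q v := by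
  have h1 := ι_mul_ι_add_swap (Q := Q) v w
  rw [negReflection_apply, map_sub, map_smul, sub_mul, smul_mul_assoc, ι_sq_scalar, hv, map_one,
    Algebra.smul_def, mul_one, ← h1, add_sub_cancel_right]

/-- The transvection attached to two orthogonal isotropic vectors. -/
def transvectionMap (u v : V) (c : ℂ) (w : V) : V := w + c • (polar Q v w • u - polar Q u w • v)

theorem transvectionMap_comp {u v : V} (hu : Q u = 0) (hv : Q v = 0) (huv : polar Q u v = 0)
    (c d : ℂ) (w : V) : transvectionMap (Q := Q) u v c (transvectionMap (Q := Q) u v d w) =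
      transvectionMap (Q := Q) u v (c + d) w := by
  have hvu : polar Q v u = 0 := by rw [polar_comm, huv]
  simp only [transvectionMap, polar_add_right, polar_smul_right, polar_sub_right, polar_self, hu,
    hv, huv, hvu, smul_zero, sub_zero, add_zero]
  module

/-- The transvection attached to two orthogonal isotropic vectors, as a linear equivalence. -/
def transvection {u v : V} (hu : Q u = 0) (hv : Q v = 0) (huv : polar Q u v = 0) (c : ℂ) :
    V ≃ₗ[ℂ] V where
  toFun := transvectionMap (Q := Q) u v c
  map_add' w w' := by
    simp only [transvectionMap, polar_add_right]; module
  map_smul' a w := by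
    simp only [transvectionMap, polar_smul_right, RingHom.id_apply, smul_eq_mul]; module
  invFun := transvectionMap (Q := Q) u v (-c)
  left_inv w := by
    rw [transvectionMap_comp hu hv huv, neg_add_cancel]; simp [transvectionMap]
  right_inv w := by
    rw [transvectionMap_comp hu hv huv, add_neg_cancel]; simp [transvectionMap]

theorem transvection_apply {u v : V} (hu : Q u = 0) (hv : Q v = 0) (huv : polar Q u v = 0) (c : ℂ)
    (w : V) : transvection hu hv huv c w = w + c • (polar Q v w • u - polar Q u w • v) := rfl

theorem Q_transvection {u v : V} (hu : Q u = 0) (hv : Q v = 0) (huv : polar Q u v = 0) (c : ℂ)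
    (w : V) : Q (transvection hu hv huv c w) = Q w := by
  rw [transvection_apply, QuadraticMap.map_add Q, QuadraticMap.map_smul, sub_eq_add_neg,
    QuadraticMap.map_add Q, QuadraticMap.map_neg, QuadraticMap.map_smul, QuadraticMap.map_smul,
    hu, hv, polar_smul_right, polar_add_right, polar_neg_right, polar_smul_right,
    polar_smul_right, polar_neg_right, polar_smul_left, polar_smul_right, huv, polar_comm Q w u,
    polar_comm Q w v]
  simp only [smul_eq_mul]
  ring

theorem one_add_mul_ι {u v : V} (hu : Q u = 0) (hv : Q v = 0) (huv : polar Q u v = 0) (c : ℂ)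
    (w : V) : (1 + c • (ι Q u * ι Q v)) * ι Q w =
      ι Q (transvection hu hv huv c w) * (1 + c • (ι Q u * ι Q v)) := by
  have huu : ι Q u * ι Q u = 0 := by rw [ι_sq_scalar, hu, map_zero]
  have hvv : ι Q v * ι Q v = 0 := by rw [ι_sq_scalar, hv, map_zero]
  have hvu : ι Q v * ι Q u = -(ι Q u * ι Q v) := by
    have := ι_mul_ι_add_swap (Q := Q) v u
    rwa [polar_comm, huv, map_zero, add_eq_zero_iff_eq_neg] at this
  have h1 : ι Q u * (ι Q u * ι Q v) = 0 := by rw [← mul_assoc, huu, zero_mul]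
  have h2 : ι Q v * (ι Q u * ι Q v) = 0 := by
    rw [← mul_assoc, hvu, neg_mul, mul_assoc, hvv, mul_zero, neg_zero]
  have h3 : ι Q v * ι Q w = polar Q v w • 1 - ι Q w * ι Q v := by
    rw [← Algebra.algebraMap_eq_smul_one, ← ι_mul_ι_add_swap, add_sub_cancel_right]
  have h4 : ι Q u * ι Q w = polar Q u w • 1 - ι Q w * ι Q u := by
    rw [← Algebra.algebraMap_eq_smul_one, ← ι_mul_ι_add_swap, add_sub_cancel_right]
  have h5 : ι Q u * ι Q v * ι Q w =
      ι Q w * (ι Q u * ι Q v) + (polar Q v w • ι Q u - polar Q u w • ι Q v) := by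
    rw [mul_assoc, h3, mul_sub, ← mul_assoc, h4, sub_mul, mul_smul_comm, mul_one, smul_mul_assoc,
      one_mul, mul_assoc]
    abel
  rw [transvection_apply, map_add, map_smul, map_sub, map_smul, map_smul, add_mul, one_mul,
    smul_mul_assoc, h5, mul_add, mul_one, add_mul, mul_smul_comm]
  simp only [smul_mul_assoc, mul_smul_comm, sub_mul, h1, h2, smul_zero, sub_zero, add_zero,
    smul_add]
  abel

/-! ### The exponential chart -/

theorem polar_e_f (i j : Fin h) : polar Q (S.e i : V) (S.f j) = if i = j then 1 else 0 := by
  rw [polar_comm, S.polar_f_e]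
  simp only [eq_comm]

theorem polar_e_e (i j : Fin h) : polar Q (S.e i : V) (S.e j) = 0 :=
  S.isotropicE.polar_eq_zero (S.e i).2 (S.e j).2

theorem polar_f_f (i j : Fin h) : polar Q (S.f i : V) (S.f j) = 0 :=
  S.isotropicF.polar_eq_zero (S.f i).2 (S.f j).2

theorem Q_e (i : Fin h) : Q (S.e i : V) = 0 := S.isotropicE _ (S.e i).2

theorem Q_f (i : Fin h) : Q (S.f i : V) = 0 := S.isotropicF _ (S.f i).2

end DualFrame

/-- The pairs `j < i` of indices; such a pair is written `⟨i, j⟩`. -/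
abbrev IndexPair (h : ℕ) : Type := Σ i : Fin h, Fin i

namespace IndexPair

variable {h : ℕ}

/-- The smaller index of a pair. -/
def lo (p : IndexPair h) : Fin h := ⟨p.2, p.2.2.trans p.1.2⟩

/-- The larger index of a pair. -/
def hi (p : IndexPair h) : Fin h := p.1

theorem lo_lt_hi (p : IndexPair h) : p.lo < p.hi := p.2.2

theorem ext_of_eq {p q : IndexPair h} (h1 : p.lo = q.lo) (h2 : p.hi = q.hi) : p = q := by
  obtain ⟨i, j⟩ := p
  obtain ⟨i', j'⟩ := q
  obtain rfl : i = i' := h2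
  have : (j : ℕ) = j' := Fin.mk.inj h1
  rw [Fin.ext this]

theorem card : Fintype.card (IndexPair h) = h * (h - 1) / 2 := by
  rw [Fintype.card_sigma]
  simp only [Fintype.card_fin]
  rw [Fin.sum_univ_eq_sum_range (fun i => i), Finset.sum_range_id]

end IndexPair

namespace DualFrame

variable {h : ℕ} (S : DualFrame Q E F h)

/-- The bivector of `E` attached to a pair of indices. -/
def bivector (p : IndexPair h) : Spinors Q E := ι _ (S.e p.lo) * ι _ (S.e p.hi)

/-- The product of the spinors `1 + A_p e_j e_i` over a list of pairs `p`. -/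
def expList (l : List (IndexPair h)) (A : IndexPair h → ℂ) : Spinors Q E :=
  (l.map fun p => 1 + A p • S.bivector p).prod

/-- The exponential of the bivector with coordinates `A`: the affine chart of the even pure
spinors around the spinor `1`. Since the bivectors `e_j e_i` commute and have square zero, the
exponential of `∑ A_p e_j e_i` is the product of the factors `1 + A_p e_j e_i`. -/
def expChart (A : IndexPair h → ℂ) : Spinors Q E := S.expList Finset.univ.toList A

theorem expList_nil (A : IndexPair h → ℂ) : S.expList [] A = 1 := rfl

theorem expList_cons (p : IndexPair h) (l : List (IndexPair h)) (A : IndexPair h → ℂ) :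
    S.expList (p :: l) A = (1 + A p • S.bivector p) * S.expList l A := rfl

theorem aug_expList (l : List (IndexPair h)) (A : IndexPair h → ℂ) : S.aug (S.expList l A) = 1 := by
  induction l with
  | nil => rw [expList_nil, map_one]
  | cons p l ih =>
    rw [expList_cons, map_mul, ih, mul_one, map_add, map_one, map_smul, bivector, aug_ι_mul,
      smul_zero, add_zero]

theorem bivector_mul_self (p : IndexPair h) : S.bivector p * S.bivector p = 0 := by
  have h1 := ι_mul_ι_add_swap (Q := Q.comp E.subtype) (S.e p.hi) (S.e p.lo)
  have h2 : polar (Q.comp E.subtype) (S.e p.hi) (S.e p.lo) = 0 := S.polar_e_e _ _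
  rw [h2, map_zero, add_eq_zero_iff_eq_neg] at h1
  rw [bivector, mul_assoc, ← mul_assoc (ι _ (S.e p.hi)), h1, neg_mul, mul_neg, mul_assoc,
    ι_sq_scalar, S.Q_eq_zero]
  simp

theorem isUnit_expList (l : List (IndexPair h)) (A : IndexPair h → ℂ) :
    IsUnit (S.expList l A) := by
  induction l with
  | nil => exact isUnit_one
  | cons p l ih =>
    rw [expList_cons]
    refine IsUnit.mul ?_ ih
    refine ⟨⟨1 + A p • S.bivector p, 1 - A p • S.bivector p, ?_, ?_⟩, rfl⟩ <;>
    · simp [mul_add, add_mul, mul_sub, sub_mul, S.bivector_mul_self]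

theorem expList_mem_even (l : List (IndexPair h)) (A : IndexPair h → ℂ) :
    S.expList l A ∈ EvenSpinors Q E := by
  rw [EvenSpinors, ← even_toSubmodule, Subalgebra.mem_toSubmodule]
  refine Subalgebra.list_prod_mem _ fun x hx => ?_
  obtain ⟨p, -, rfl⟩ := List.mem_map.1 hx
  exact add_mem (one_mem _) (Subalgebra.smul_mem _ (ι_mul_ι_mem_evenOdd_zero _ _ _) _)

/-- The displacement of the vector `v` under the isometry that corresponds to multiplication by
`expList l A`. It lies in `E`, which the isometry fixes, so the displacements of the factors add
up. -/
def bivectorShift (l : List (IndexPair h)) (A : IndexPair h → ℂ) (v : V) : V :=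
  (l.map fun p => A p • (polar Q (S.e p.hi : V) v • (S.e p.lo : V) -
    polar Q (S.e p.lo : V) v • (S.e p.hi : V))).sum

theorem bivectorShift_mem (l : List (IndexPair h)) (A : IndexPair h → ℂ) (v : V) :
    S.bivectorShift l A v ∈ E := by
  refine list_sum_mem fun x hx => ?_
  obtain ⟨p, -, rfl⟩ := List.mem_map.1 hx
  exact E.smul_mem _ (E.sub_mem (E.smul_mem _ (S.e _).2) (E.smul_mem _ (S.e _).2))

theorem spinorsToClifford_bivector (p : IndexPair h) :
    spinorsToClifford Q E (S.bivector p) = ι Q (S.e p.lo : V) * ι Q (S.e p.hi : V) := by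
  rw [bivector, map_mul, spinorsToClifford_ι, spinorsToClifford_ι]

/-- Multiplication by the exponential is equivariant for the shift of vectors it induces. -/
theorem expList_mul_act_ι (l : List (IndexPair h)) (A : IndexPair h → ℂ) (v : V)
    (s : Spinors Q E) :
    S.expList l A * S.act (ι Q v) s =
      S.act (ι Q (v + S.bivectorShift l A v)) (S.expList l A * s) := by
  induction l with
  | nil => simp [expList_nil, bivectorShift]
  | cons p l ih =>
    have h1 := one_add_mul_ι (S.Q_e p.lo) (S.Q_e p.hi) (S.polar_e_e _ _) (A p)
      (v + S.bivectorShift l A v)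
    have h2 : transvection (S.Q_e p.lo) (S.Q_e p.hi) (S.polar_e_e _ _) (A p)
        (v + S.bivectorShift l A v) = v + S.bivectorShift (p :: l) A v := by
      have hmem := S.bivectorShift_mem l A v
      rw [transvection_apply, polar_add_right, polar_add_right,
        S.isotropicE.polar_eq_zero (S.e p.hi).2 hmem, S.isotropicE.polar_eq_zero (S.e p.lo).2 hmem,
        add_zero, add_zero, bivectorShift, bivectorShift, List.map_cons, List.sum_cons]
      abel
    have h3 : spinorsToClifford Q E (1 + A p • S.bivector p) =
        1 + A p • (ι Q (S.e p.lo : V) * ι Q (S.e p.hi : V)) := by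
      rw [map_add, map_one, map_smul, spinorsToClifford_bivector]
    rw [expList_cons, mul_assoc, ih, ← act_spinorsToClifford, h3, ← act_mul, h1, h2, act_mul,
      ← h3, act_spinorsToClifford, mul_assoc]

theorem isPureSpinor_expList (hF : IsMaximalTotallyIsotropic Q F) (l : List (IndexPair h))
    (A : IndexPair h → ℂ) : IsPureSpinor Q E F (S.expList l A) := by
  induction l with
  | nil => exact S.isPureSpinor_one hF
  | cons p l ih =>
    have h3 : S.expList (p :: l) A =
        S.act (1 + A p • (ι Q (S.e p.lo : V) * ι Q (S.e p.hi : V))) (S.expList l A) := by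
      rw [expList_cons, ← act_spinorsToClifford, map_add, map_one, map_smul,
        spinorsToClifford_bivector]
    rw [h3]
    refine S.isPureSpinor_act (Q_transvection (S.Q_e p.lo) (S.Q_e p.hi) (S.polar_e_e _ _) (A p))
      (one_add_mul_ι (S.Q_e p.lo) (S.Q_e p.hi) (S.polar_e_e _ _) (A p)) ih ?_
    rw [← h3]
    intro h0
    have := S.aug_expList (p :: l) A
    rw [h0, map_zero] at this
    exact zero_ne_one this

theorem bivectorShift_univ_f (A : IndexPair h → ℂ) {a : Fin h → Fin h → ℂ}
    (ha : ∀ i j, a j i = -a i j) (ha0 : ∀ i, a i i = 0)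
    (hA : ∀ p : IndexPair h, A p = -a p.hi p.lo) (i : Fin h) :
    S.bivectorShift Finset.univ.toList A (S.f i : V) = -∑ j, a i j • (S.e j : V) := by
  have h1 : S.bivectorShift Finset.univ.toList A (S.f i : V) = ∑ k : Fin h, ∑ j : Fin k,
      A ⟨k, j⟩ • ((if k = i then (1 : ℂ) else 0) • (S.e (IndexPair.lo ⟨k, j⟩) : V) -
        (if IndexPair.lo ⟨k, j⟩ = i then (1 : ℂ) else 0) • (S.e k : V)) := by
    rw [bivectorShift, Finset.sum_map_toList, ← Finset.univ_sigma_univ, Finset.sum_sigma]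
    simp only [S.polar_e_f]
    rfl
  have h2 : ∀ k : Fin h, ∑ j : Fin k,
      A ⟨k, j⟩ • ((if k = i then (1 : ℂ) else 0) • (S.e (IndexPair.lo ⟨k, j⟩) : V) -
        (if IndexPair.lo ⟨k, j⟩ = i then (1 : ℂ) else 0) • (S.e k : V)) =
      ∑ j : Fin h, if j < k then -a k j • ((if k = i then (1 : ℂ) else 0) • (S.e j : V) -
        (if j = i then (1 : ℂ) else 0) • (S.e k : V)) else 0 := by
    intro k
    rw [← Finset.sum_filter]
    refine Finset.sum_bij (fun j _ => IndexPair.lo ⟨k, j⟩) (fun j _ => ?_) (fun j _ j' _ hj => ?_)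
      (fun j hj => ?_) (fun j _ => ?_)
    · simp only [Finset.mem_filter, Finset.mem_univ, true_and]
      exact j.2
    · exact Fin.ext (Fin.mk.inj hj)
    · simp only [Finset.mem_filter, Finset.mem_univ, true_and] at hj
      exact ⟨⟨j, hj⟩, Finset.mem_univ _, rfl⟩
    · rw [hA]
      rfl
  rw [h1, Finset.sum_congr rfl fun k _ => h2 k, ← Finset.sum_neg_distrib]
  have h3 : ∀ k j : Fin h, (if j < k then -a k j • ((if k = i then (1 : ℂ) else 0) • (S.e j : V) -
        (if j = i then (1 : ℂ) else 0) • (S.e k : V)) else 0) =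
      (if k = i then (if j < i then -a i j • (S.e j : V) else 0) else 0) +
        (if j = i then (if i < k then -a i k • (S.e k : V) else 0) else 0) := by
    intro k j
    by_cases hk : k = i
    · subst hk
      by_cases hj : j = k
      · subst hj; simp
      · simp [hj]
    · by_cases hj : j = i
      · subst hj
        rw [ha j k]
        simp [hk]
      · simp [hk, hj]
  simp only [h3, Finset.sum_add_distrib]
  rw [Finset.sum_eq_single i (fun k _ hk => by simp [hk]) (by simp)]
  simp only [if_true, Finset.sum_ite_eq', Finset.mem_univ]
  rw [← Finset.sum_add_distrib]
  refine Finset.sum_congr rfl fun j _ => ?_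
  rcases lt_trichotomy j i with hj | rfl | hj
  · simp [hj, hj.not_gt]
  · simp [ha0]
  · simp [hj, hj.not_gt]

theorem aug_eq_zero_of_ι_mul_eq_zero {v : E} (hv : v ≠ 0) {s : Spinors Q E}
    (hs : ι _ v * s = 0) : S.aug s = 0 := by
  obtain ⟨i, hi⟩ : ∃ i, S.e.repr v i ≠ 0 := by
    by_contra! h0
    exact hv (S.e.repr.map_eq_zero_iff.1 (Finsupp.ext h0))
  have hpol : pairing Q E (S.f i : V) v = S.e.repr v i := by
    have : pairing Q E (S.f i : V) = S.e.coord i := by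
      refine S.e.ext fun j => ?_
      rw [pairing_apply, S.polar_f_e, Module.Basis.coord_apply, Module.Basis.repr_self,
        Finsupp.single_apply]
      simp only [eq_comm]
    rw [this, Module.Basis.coord_apply]
  have h1 : CliffordAlgebra.contractLeft (pairing Q E (S.f i : V)) (ι _ v * s) = 0 := by
    rw [hs, map_zero]
  rw [contractLeft_ι_mul, hpol, sub_eq_zero] at h1
  have h2 := congrArg S.aug h1
  rw [map_smul, aug_ι_mul, smul_eq_mul, mul_eq_zero] at h2
  exact h2.resolve_left hi

/-- A pure spinor whose component of degree zero does not vanish is a multiple of a point of the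
exponential chart: its subspace is the graph of a skew-symmetric map `F → E`. -/
theorem exists_eq_smul_expChart [FiniteDimensional ℂ V] (hV : Module.finrank ℂ V = 2 * h)
    {s : Spinors Q E} (hs : IsPureSpinor Q E F s) (hs0 : S.aug s ≠ 0) :
    ∃ A, s = S.aug s • S.expChart A := by
  obtain ⟨W, hW, hsW⟩ := hs
  have hann : ∀ w ∈ W, S.act (ι Q w) s = 0 := fun w hw =>
    S.act_eq_zero_of_isRepresentativeSpinor hW.1 hsW hw
  have hdisj : Disjoint W E := by
    rw [Submodule.disjoint_def]
    intro w hw hwE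
    by_contra hw0
    refine hs0 (S.aug_eq_zero_of_ι_mul_eq_zero (v := ⟨w, hwE⟩) (by simpa using hw0) ?_)
    rw [← act_ι_of_mem_E]
    exact hann w hw
  have hfE : Module.finrank ℂ E = h := by rw [Module.finrank_eq_card_basis S.e, Fintype.card_fin]
  have hsup : W ⊔ E = ⊤ := by
    apply Submodule.eq_top_of_finrank_eq
    have h1 := Submodule.finrank_sup_add_finrank_inf_eq W E
    rw [hdisj.eq_bot, finrank_bot, hfE] at h1
    have h2 := hW.finrank_le
    have h3 := (W ⊔ E).finrank_le
    omega
  have hgraph : ∀ i, ∃ a : Fin h → ℂ, (S.f i : V) + ∑ j, a j • (S.e j : V) ∈ W := by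
    intro i
    obtain ⟨w, hw, x, hx, hwx⟩ := Submodule.mem_sup.1
      (show (S.f i : V) ∈ W ⊔ E by rw [hsup]; trivial)
    refine ⟨fun j => -S.e.repr ⟨x, hx⟩ j, ?_⟩
    have hsum := congrArg E.subtype (S.e.sum_repr ⟨x, hx⟩)
    rw [map_sum] at hsum
    have : (S.f i : V) + ∑ j, (-S.e.repr ⟨x, hx⟩ j) • (S.e j : V) = w := by
      simp only [neg_smul, Finset.sum_neg_distrib]
      rw [← hwx]
      have hx' : ∑ j, S.e.repr ⟨x, hx⟩ j • (S.e j : V) = x := hsum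
      rw [hx', add_neg_cancel_right]
    rwa [this]
  choose a ha using hgraph
  have hpol : ∀ i j, polar Q ((S.f i : V) + ∑ k, a i k • (S.e k : V))
      ((S.f j : V) + ∑ k, a j k • (S.e k : V)) = a j i + a i j := by
    intro i j
    have hmem : ∀ i, ∑ k, a i k • (S.e k : V) ∈ E := fun i =>
      E.sum_mem fun k _ => E.smul_mem _ (S.e k).2
    have hfe : ∀ i j, polar Q (S.f i : V) (∑ k, a j k • (S.e k : V)) = a j i := by
      intro i j
      have h1 : polar Q (S.f i : V) (∑ k, a j k • (S.e k : V)) =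
          Q.polarBilin (S.f i : V) (∑ k, a j k • (S.e k : V)) := rfl
      rw [h1, map_sum]
      simp only [map_smul, polarBilin_apply_apply, S.polar_f_e, smul_eq_mul, mul_ite, mul_one,
        mul_zero, Finset.sum_ite_eq, Finset.mem_univ, if_true]
    rw [polar_add_left, polar_add_right, polar_add_right, S.polar_f_f, hfe,
      S.isotropicE.polar_eq_zero (hmem i) (hmem j), polar_comm, hfe]
    ring
  have hskew : ∀ i j, a j i = -a i j := fun i j => by
    rw [← add_eq_zero_iff_eq_neg, ← hpol]
    exact hW.1.polar_eq_zero (ha i) (ha j)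
  have hdiag : ∀ i, a i i = 0 := fun i => by
    have := hskew i i
    linear_combination this / 2
  -- both shifts below move between the graph of `a` and `F`
  let A : IndexPair h → ℂ := fun p => -a p.hi p.lo
  have hshift := S.bivectorShift_univ_f A hskew hdiag fun p => rfl
  have hshift' := S.bivectorShift_univ_f (fun p => -A p) (a := fun i j => -a i j)
    (fun i j => by rw [hskew]) (fun i => by simp [hdiag]) fun p => rfl
  have hflat : ∀ t : Spinors Q E,
      (∀ i, S.act (ι Q ((S.f i : V) + ∑ j, a i j • (S.e j : V))) t = 0) →
      S.expChart A * t = algebraMap ℂ _ (S.aug t) := by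
    intro t ht
    have : S.aug t = S.aug (S.expChart A * t) := by
      rw [map_mul, expChart, aug_expList, one_mul]
    rw [this]
    refine S.eq_aug_of_forall_act_f fun i => ?_
    have h1 := S.expList_mul_act_ι Finset.univ.toList A ((S.f i : V) + ∑ j, a i j • (S.e j : V)) t
    rw [ht i, mul_zero] at h1
    have h2 : S.bivectorShift Finset.univ.toList A ((S.f i : V) + ∑ j, a i j • (S.e j : V)) =
        S.bivectorShift Finset.univ.toList A (S.f i : V) := by
      have hmem : ∑ k, a i k • (S.e k : V) ∈ E := E.sum_mem fun k _ => E.smul_mem _ (S.e k).2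
      simp only [bivectorShift, polar_add_right, S.isotropicE.polar_eq_zero (S.e _).2 hmem,
        add_zero]
    rw [h2, hshift, add_neg_cancel_right] at h1
    exact h1.symm
  have hchart : ∀ i, S.act (ι Q ((S.f i : V) + ∑ j, a i j • (S.e j : V)))
      (S.expChart fun p => -A p) = 0 := by
    intro i
    have h1 := S.expList_mul_act_ι Finset.univ.toList (fun p => -A p) (S.f i : V) 1
    rw [hshift', act_ι_of_mem_F, contractLeft_one, mul_zero, mul_one] at h1
    simp only [neg_smul, Finset.sum_neg_distrib, neg_neg] at h1
    exact h1.symm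
  refine ⟨fun p => -A p, (S.isUnit_expList Finset.univ.toList A).mul_left_cancel ?_⟩
  have h1 : S.expList Finset.univ.toList A * s = _ := hflat s fun i => hann _ (ha i)
  have h2 : S.expList Finset.univ.toList A * S.expChart (fun p => -A p) = _ := hflat _ hchart
  have h3 : S.aug (S.expChart fun p => -A p) = 1 := S.aug_expList _ _
  rw [mul_smul_comm, h1, h2, h3, map_one, Algebra.algebraMap_eq_smul_one]

end DualFrame

end PureSpinors

section Charts

variable {V : Type*} [AddCommGroup V] [Module ℂ V] {Q : QuadraticForm ℂ V} {E F : Submodule ℂ V}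

namespace DualFrame

variable {h : ℕ} (S : DualFrame Q E F h)

/-! ### Moving the exponential chart -/

/-- The unit vector `e_i + f_i`, which interchanges the spinors with and without a factor `e_i`. -/
def flip (i : Fin h) : V := S.e i + S.f i

theorem Q_flip (i : Fin h) : Q (S.flip i) = 1 := by
  rw [flip, QuadraticMap.map_add Q, Q_e, Q_f, polar_e_f, if_pos rfl]
  simp

/-- The action of the product of the vectors `e_i + f_i` over a list of indices. -/
def flipAct (l : List (Fin h)) : Module.End ℂ (Spinors Q E) :=
  S.act ((l.map S.flip).map (ι Q)).prod

theorem flipAct_nil : S.flipAct [] = 1 := map_one _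

theorem flipAct_cons (i : Fin h) (l : List (Fin h)) (x : Spinors Q E) :
    S.flipAct (i :: l) x = S.act (ι Q (S.flip i)) (S.flipAct l x) := by
  rw [flipAct, List.map_cons, List.map_cons, List.prod_cons, act_mul]
  rfl

theorem flipAct_append (l l' : List (Fin h)) (x : Spinors Q E) :
    S.flipAct (l ++ l') x = S.flipAct l (S.flipAct l' x) := by
  rw [flipAct, List.map_append, List.map_append, List.prod_append, act_mul]
  rfl

theorem act_flip_flip (i : Fin h) (x : Spinors Q E) :
    S.act (ι Q (S.flip i)) (S.act (ι Q (S.flip i)) x) = x := by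
  rw [← act_mul, ι_sq_scalar, Q_flip, map_one, map_one, Module.End.one_apply]

theorem flipAct_reverse_flipAct (l : List (Fin h)) (x : Spinors Q E) :
    S.flipAct l.reverse (S.flipAct l x) = x := by
  induction l with
  | nil => simp [flipAct_nil]
  | cons i l ih =>
    rw [List.reverse_cons, flipAct_append, flipAct_cons, flipAct_cons, flipAct_nil,
      Module.End.one_apply, act_flip_flip, ih]

theorem flipAct_injective (l : List (Fin h)) : Function.Injective (S.flipAct l) :=
  Function.LeftInverse.injective (S.flipAct_reverse_flipAct l)

theorem isPureSpinor_flipAct (l : List (Fin h)) {s : Spinors Q E} (hs : IsPureSpinor Q E F s) :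
    IsPureSpinor Q E F (S.flipAct l s) := by
  induction l with
  | nil => simpa [flipAct_nil] using hs
  | cons i l ih =>
    rw [flipAct_cons]
    refine S.isPureSpinor_act (Q_negReflection (S.Q_flip i))
      (ι_mul_ι_negReflection (S.Q_flip i)) ih fun h0 => ?_
    rw [← flipAct_cons] at h0
    obtain ⟨W, -, hne, -⟩ := hs
    exact hne (S.flipAct_injective _ (h0.trans (map_zero _).symm))

/-- The action of the product of the vectors `f_i` over a list of indices. -/
def contractAct (l : List (Fin h)) : Module.End ℂ (Spinors Q E) :=
  S.act ((l.map fun i => (S.f i : V)).map (ι Q)).prod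

theorem contractAct_append (l l' : List (Fin h)) (x : Spinors Q E) :
    S.contractAct (l ++ l') x = S.contractAct l (S.contractAct l' x) := by
  rw [contractAct, List.map_append, List.map_append, List.prod_append, act_mul]
  rfl

theorem contractAct_cons (i : Fin h) (l : List (Fin h)) (x : Spinors Q E) :
    S.contractAct (i :: l) x = S.act (ι Q (S.f i : V)) (S.contractAct l x) := by
  rw [contractAct, List.map_cons, List.map_cons, List.prod_cons, act_mul]
  rfl

theorem contractAct_nil : S.contractAct [] = 1 := map_one _

theorem aug_contractAct_e (l : List (Fin h)) {i : Fin h} (hi : i ∉ l) (x : Spinors Q E) :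
    S.aug (S.contractAct l (S.act (ι Q (S.e i : V)) x)) = 0 := by
  suffices ∃ c : ℂ, ∀ x, S.contractAct l (S.act (ι Q (S.e i : V)) x) =
      c • S.act (ι Q (S.e i : V)) (S.contractAct l x) by
    obtain ⟨c, hc⟩ := this
    rw [hc, act_ι_of_mem_E, map_smul, aug_ι_mul, smul_zero]
  induction l with
  | nil => exact ⟨1, fun x => by simp [contractAct_nil]⟩
  | cons j l ih =>
    obtain ⟨c, hc⟩ := ih fun h => hi (List.mem_cons_of_mem _ h)
    refine ⟨-c, fun x => ?_⟩
    have hij : j ≠ i := fun h => hi (by simp [h])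
    have hswap := ι_mul_ι_add_swap (Q := Q) (S.f j : V) (S.e i : V)
    rw [S.polar_f_e, if_neg hij, map_zero, add_eq_zero_iff_eq_neg] at hswap
    rw [contractAct_cons, contractAct_cons, hc, map_smul, ← act_mul, hswap, map_neg,
      LinearMap.neg_apply, act_mul, smul_neg, neg_smul]

/-- In degree zero, flipping distinct indices is the same as contracting them. -/
theorem aug_flipAct {l : List (Fin h)} (hl : l.Nodup) (x : Spinors Q E) :
    S.aug (S.flipAct l x) = S.aug (S.contractAct l x) := by
  suffices ∀ l' : List (Fin h), (l' ++ l).Nodup →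
      S.aug (S.contractAct l' (S.flipAct l x)) = S.aug (S.contractAct (l' ++ l) x) by
    simpa [contractAct_nil] using this [] hl
  induction l with
  | nil => intro l' _; simp [flipAct_nil]
  | cons i l ih =>
    intro l' hl'
    have hi : i ∉ l' := fun h =>
      (List.nodup_append.1 hl').2.2 i h i List.mem_cons_self rfl
    have hl'' : l' ++ i :: l = (l' ++ [i]) ++ l := by simp
    rw [hl''] at hl' ⊢
    rw [← ih (List.nodup_cons.1 hl).2 _ hl', flipAct_cons, flip, map_add (ι Q), map_add S.act,
      LinearMap.add_apply, map_add, map_add, aug_contractAct_e _ _ hi, zero_add,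
      contractAct_append, contractAct_cons, contractAct_nil, Module.End.one_apply]

/-- A nonzero spinor has a nonvanishing component of degree zero after flipping suitable
indices: contract it as long as possible without killing it. -/
theorem exists_aug_contractAct_ne_zero {s : Spinors Q E} (hs : s ≠ 0) :
    ∃ l : List (Fin h), l.Nodup ∧ S.aug (S.contractAct l s) ≠ 0 := by
  obtain ⟨⟨l, hl⟩, hls, hmax⟩ := Set.Finite.exists_maximalFor
    (fun l : {l : List (Fin h) // l.Nodup} => l.1.length)
    {l | S.contractAct l.1 s ≠ 0} (Set.toFinite _)
    ⟨⟨[], List.nodup_nil⟩, by simpa [contractAct_nil] using hs⟩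
  refine ⟨l, hl, fun h0 => hls ?_⟩
  have hkill : ∀ i, S.act (ι Q (S.f i : V)) (S.contractAct l s) = 0 := by
    intro i
    by_cases hi : i ∈ l
    · rw [contractAct, ← act_mul, ι_mul_list_prod_eq_zero S.isotropicF
        (l := l.map fun i => (S.f i : V)) (by simp) (List.mem_map.2 ⟨i, hi, rfl⟩), map_zero,
        LinearMap.zero_apply]
    · by_contra hne
      rw [← contractAct_cons] at hne
      have := hmax (j := ⟨i :: l, List.nodup_cons.2 ⟨hi, hl⟩⟩) hne (by simp)
      simp at this
  rw [S.eq_aug_of_forall_act_f hkill, h0, map_zero]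

include S in
theorem finiteDimensional_spinors : FiniteDimensional ℂ (Spinors Q E) := by
  let c : Spinors Q E →ₗ[ℂ] ({l : List (Fin h) // l.Nodup} → ℂ) :=
    LinearMap.pi fun l => S.aug.toLinearMap.comp (S.contractAct l.1)
  refine FiniteDimensional.of_injective c ((injective_iff_map_eq_zero c).2 fun s hs => ?_)
  by_contra hne
  obtain ⟨l, hl, hls⟩ := S.exists_aug_contractAct_ne_zero hne
  exact hls (congrFun hs ⟨l, hl⟩)

/-! ### Parity -/

theorem contractLeft_mem_evenOdd (d : Module.Dual ℂ E) {n : ZMod 2} {x : Spinors Q E}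
    (hx : x ∈ evenOdd (Q.comp E.subtype) n) :
    CliffordAlgebra.contractLeft d x ∈ evenOdd (Q.comp E.subtype) (n + 1) := by
  induction x, hx using evenOdd_induction with
  | range_ι_pow v hv =>
    fin_cases n
    · obtain ⟨r, rfl⟩ := Submodule.mem_one.1 (show v ∈ (1 : Submodule ℂ (Spinors Q E)) from hv)
      rw [contractLeft_algebraMap]
      exact Submodule.zero_mem _
    · have hv' : v ∈ LinearMap.range (ι (Q.comp E.subtype)) := by
        rw [← pow_one (LinearMap.range (ι (Q.comp E.subtype)))]
        exact hv
      obtain ⟨m, rfl⟩ := hv'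
      rw [contractLeft_ι]
      exact SetLike.algebraMap_mem_graded (evenOdd (Q.comp E.subtype)) (d m)
  | add x y hx hy ihx ihy => rw [map_add]; exact Submodule.add_mem _ ihx ihy
  | ι_mul_ι_mul a b x hx ih =>
    have hι : ∀ (m : E) (k : ZMod 2) (y : Spinors Q E), y ∈ evenOdd (Q.comp E.subtype) k →
        ι _ m * y ∈ evenOdd (Q.comp E.subtype) (k + 1) := fun m k y hy => by
      rw [add_comm]
      exact SetLike.mul_mem_graded (ι_mem_evenOdd_one _ m) hy
    have h2 : n + 1 + 1 + 1 = n + 1 := by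
      rw [add_assoc n 1 1, show (1 + 1 : ZMod 2) = 0 from rfl, add_zero]
    rw [mul_assoc, contractLeft_ι_mul, contractLeft_ι_mul]
    refine Submodule.sub_mem _ (Submodule.smul_mem _ _ (hι _ _ _ hx)) ?_
    rw [mul_sub, mul_smul_comm]
    refine Submodule.sub_mem _ (Submodule.smul_mem _ _ (hι _ _ _ hx)) ?_
    rw [← h2]
    exact hι _ _ _ (hι _ _ _ ih)

theorem act_ι_mem_evenOdd (v : V) {n : ZMod 2} {x : Spinors Q E}
    (hx : x ∈ evenOdd (Q.comp E.subtype) n) :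
    S.act (ι Q v) x ∈ evenOdd (Q.comp E.subtype) (n + 1) := by
  rw [act_ι]
  refine Submodule.add_mem _ ?_ (contractLeft_mem_evenOdd _ hx)
  rw [add_comm]
  exact SetLike.mul_mem_graded (ι_mem_evenOdd_one _ _) hx

theorem flipAct_mem_evenOdd (l : List (Fin h)) {x : Spinors Q E} (hx : x ∈ EvenSpinors Q E) :
    S.flipAct l x ∈ evenOdd (Q.comp E.subtype) (l.length : ZMod 2) := by
  induction l with
  | nil => simpa [flipAct_nil] using hx
  | cons i l ih =>
    rw [flipAct_cons, List.length_cons, Nat.cast_add, Nat.cast_one]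
    exact S.act_ι_mem_evenOdd _ ih

theorem flipAct_mem_even {l : List (Fin h)} (hl : Even l.length) {x : Spinors Q E}
    (hx : x ∈ EvenSpinors Q E) : S.flipAct l x ∈ EvenSpinors Q E := by
  have := S.flipAct_mem_evenOdd l hx
  rwa [(ZMod.natCast_eq_zero_iff_even).2 hl] at this

theorem aug_eq_zero_of_mem_odd {x : Spinors Q E} (hx : x ∈ evenOdd (Q.comp E.subtype) 1) :
    S.aug x = 0 := by
  have h1 : S.aug.comp involute = S.aug := by
    apply CliffordAlgebra.hom_ext
    ext m
    simp [aug_ι]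
  have h2 := DFunLike.congr_fun h1 x
  rw [AlgHom.comp_apply, involute_eq_of_mem_odd hx, map_neg] at h2
  linear_combination -h2 / 2

/-- The even pure spinors are covered by the translates of the exponential chart. -/
theorem exists_eq_smul_flipAct_expChart [FiniteDimensional ℂ V]
    (hV : Module.finrank ℂ V = 2 * h) {s : Spinors Q E} (hs : IsPureSpinor Q E F s)
    (heven : s ∈ EvenSpinors Q E) :
    ∃ l : List (Fin h), l.Nodup ∧ Even l.length ∧
      ∃ (c : ℂ) (A : IndexPair h → ℂ), s = c • S.flipAct l (S.expChart A) := by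
  have hs0 : s ≠ 0 := by
    obtain ⟨W, -, hne, -⟩ := hs
    exact hne
  obtain ⟨l, hl, hls⟩ := S.exists_aug_contractAct_ne_zero hs0
  rw [← S.aug_flipAct hl] at hls
  have hlen : Even l.length := by
    by_contra hodd
    refine hls (S.aug_eq_zero_of_mem_odd ?_)
    have := S.flipAct_mem_evenOdd l heven
    rwa [(ZMod.natCast_eq_one_iff_odd).2 (Nat.not_even_iff_odd.1 hodd)] at this
  obtain ⟨A, hA⟩ := S.exists_eq_smul_expChart hV (S.isPureSpinor_flipAct l hs) hls
  refine ⟨l.reverse, List.nodup_reverse.2 hl, by simpa using hlen, S.aug (S.flipAct l s), A, ?_⟩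
  rw [← map_smul, ← hA, flipAct_reverse_flipAct]

/-! ### Weights -/

/-- The spinor `x` has weight `T` if `e_j f_j` acts on it as the indicator function of `T`. -/
def HasWeight (T : Finset (Fin h)) (x : Spinors Q E) : Prop :=
  ∀ j, S.act (ι Q (S.e j : V) * ι Q (S.f j : V)) x = if j ∈ T then x else 0

theorem hasWeight_one : S.HasWeight ∅ 1 := fun j => by
  rw [act_mul, act_ι_of_mem_F, contractLeft_one, map_zero]
  simp

theorem HasWeight.flip {T : Finset (Fin h)} {x : Spinors Q E} (hx : S.HasWeight T x)
    (i : Fin h) : S.HasWeight (symmDiff T {i}) (S.act (ι Q (S.flip i)) x) := by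
  intro j
  have hee : ι Q (S.e j : V) * ι Q (S.e j : V) = 0 := by rw [ι_sq_scalar, Q_e, map_zero]
  have hff : ι Q (S.f j : V) * ι Q (S.f j : V) = 0 := by rw [ι_sq_scalar, Q_f, map_zero]
  have hpe : polar Q (S.e j : V) (S.flip i) = if j = i then 1 else 0 := by
    rw [DualFrame.flip, polar_add_right, polar_e_e, polar_e_f, zero_add]
  have hpf : polar Q (S.f j : V) (S.flip i) = if j = i then 1 else 0 := by
    rw [DualFrame.flip, polar_add_right, polar_f_f, polar_f_e, add_zero]
  by_cases hij : j = i
  · subst hij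
    have hef := ι_mul_ι_add_swap (Q := Q) (S.e j : V) (S.f j : V)
    rw [polar_e_f, if_pos rfl, map_one] at hef
    have key : ι Q (S.e j : V) * ι Q (S.f j : V) * ι Q (S.flip j) =
        ι Q (S.flip j) * (1 - ι Q (S.e j : V) * ι Q (S.f j : V)) := by
      have h1 : ι Q (S.e j : V) * ι Q (S.f j : V) = 1 - ι Q (S.f j : V) * ι Q (S.e j : V) := by
        rw [← hef, add_sub_cancel_right]
      rw [DualFrame.flip, map_add, mul_add, mul_assoc, mul_assoc, hff, mul_zero, add_zero]
      conv_rhs => rw [h1, sub_sub_cancel, add_mul, ← mul_assoc, ← mul_assoc, hff, zero_mul,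
        add_zero]
      rw [mul_assoc]
    rw [← act_mul, key, act_mul, map_sub, map_one, LinearMap.sub_apply, Module.End.one_apply,
      hx j]
    by_cases hj : j ∈ T <;> simp [Finset.mem_symmDiff, hj]
  · rw [if_neg hij] at hpe hpf
    have h1 := ι_mul_ι_add_swap (Q := Q) (S.e j : V) (S.flip i)
    have h2 := ι_mul_ι_add_swap (Q := Q) (S.f j : V) (S.flip i)
    rw [hpe, map_zero, add_eq_zero_iff_eq_neg] at h1
    rw [hpf, map_zero, add_eq_zero_iff_eq_neg] at h2
    have key : ι Q (S.e j : V) * ι Q (S.f j : V) * ι Q (S.flip i) =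
        ι Q (S.flip i) * (ι Q (S.e j : V) * ι Q (S.f j : V)) := by
      rw [mul_assoc, h2, mul_neg, ← mul_assoc, h1, neg_mul, neg_neg, mul_assoc]
    rw [← act_mul, key, act_mul, hx j]
    have : j ∈ symmDiff T {i} ↔ j ∈ T := by simp [Finset.mem_symmDiff, hij]
    simp only [this]
    split_ifs <;> simp

theorem HasWeight.flipAct {T : Finset (Fin h)} {x : Spinors Q E} (hx : S.HasWeight T x)
    {l : List (Fin h)} (hl : l.Nodup) :
    S.HasWeight (symmDiff T l.toFinset) (S.flipAct l x) := by
  induction l with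
  | nil =>
    rw [List.toFinset_nil, ← Finset.bot_eq_empty, symmDiff_bot]
    simpa [flipAct_nil] using hx
  | cons i l ih =>
    obtain ⟨hi, hl⟩ := List.nodup_cons.1 hl
    have h1 : symmDiff T (i :: l).toFinset = symmDiff (symmDiff T l.toFinset) {i} := by
      rw [symmDiff_assoc]
      congr 1
      ext j
      simp only [List.toFinset_cons, Finset.mem_insert, List.mem_toFinset, Finset.mem_symmDiff,
        Finset.mem_singleton]
      by_cases hj : j = i
      · subst hj; simp [hi]
      · simp [hj]
    rw [flipAct_cons, h1]
    exact (ih hl).flip S i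

theorem bivector_eq_flip (p : IndexPair h) :
    S.bivector p = S.act (ι Q (S.flip p.lo)) (S.act (ι Q (S.flip p.hi)) 1) := by
  have h1 : S.act (ι Q (S.flip p.hi)) 1 = ι _ (S.e p.hi) := by
    rw [flip, map_add, map_add, LinearMap.add_apply, act_ι_of_mem_E, act_ι_of_mem_F,
      contractLeft_one, mul_one, add_zero]
  rw [h1, flip, map_add, map_add, LinearMap.add_apply, act_ι_of_mem_E, act_ι_of_mem_F,
    contractLeft_ι, pairing_apply, polar_f_e, if_neg p.lo_lt_hi.ne, map_zero, add_zero]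
  rfl

theorem bivector_ne_zero (p : IndexPair h) : S.bivector p ≠ 0 := by
  rw [bivector_eq_flip]
  intro h0
  have h1 := congrArg (fun x => S.act (ι Q (S.flip p.hi)) (S.act (ι Q (S.flip p.lo)) x)) h0
  simp only [act_flip_flip, map_zero] at h1
  have := congrArg S.aug h1
  simp at this

theorem hasWeight_bivector (p : IndexPair h) : S.HasWeight {p.lo, p.hi} (S.bivector p) := by
  rw [bivector_eq_flip]
  have h1 := (S.hasWeight_one.flip S p.hi).flip S p.lo
  have h2 : symmDiff (symmDiff ∅ {p.hi}) {p.lo} = ({p.lo, p.hi} : Finset (Fin h)) := by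
    ext j
    have := p.lo_lt_hi.ne
    simp only [Finset.mem_symmDiff, Finset.mem_insert, Finset.mem_singleton, Finset.notMem_empty]
    grind
  rwa [h2] at h1

/-- Nonzero spinors of distinct weights are linearly independent. -/
theorem linearIndependent_of_hasWeight {ι' : Type*} {T : ι' → Finset (Fin h)}
    (hT : Function.Injective T) {x : ι' → Spinors Q E} (hx : ∀ i, S.HasWeight (T i) (x i))
    (hx0 : ∀ i, x i ≠ 0) : LinearIndependent ℂ x := by
  -- the binary expansion separates the weights by the eigenvalues of a single operator
  let N : Module.End ℂ (Spinors Q E) :=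
    ∑ j : Fin h, (2 ^ (j : ℕ) : ℂ) • S.act (ι Q (S.e j : V) * ι Q (S.f j : V))
  let μ : ι' → ℂ := fun i => ((∑ k ∈ (T i).map Fin.valEmbedding, 2 ^ k : ℕ) : ℂ)
  refine Module.End.eigenvectors_linearIndependent' N μ (fun i i' hii' => ?_) x fun i =>
    ⟨Module.End.mem_eigenspace_iff.2 ?_, hx0 i⟩
  · exact hT (Finset.map_injective _ (Finset.geomSum_injective le_rfl (Nat.cast_injective hii')))
  · simp only [N, μ, LinearMap.sum_apply, LinearMap.smul_apply, hx i _, smul_ite, smul_zero]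
    rw [← Finset.sum_filter, ← Finset.sum_smul, Finset.sum_map]
    push_cast
    congr 1
    refine Finset.sum_congr (by ext; simp) fun j _ => rfl

end DualFrame

end Charts

/-! ### Dual families of linear forms -/

/-- A linearly independent family has a dual family of linear forms. -/
theorem exists_dual_family {W ι' : Type*} [AddCommGroup W] [Module ℂ W] [DecidableEq ι']
    {v : ι' → W} (hv : LinearIndependent ℂ v) :
    ∃ u : ι' → Module.Dual ℂ W, ∀ i j, u i (v j) = if i = j then 1 else 0 := by
  have hex : ∀ i, ∃ u : Module.Dual ℂ W, ∀ j, u (v j) = if i = j then 1 else 0 := by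
    intro i
    obtain ⟨u, hu⟩ := LinearMap.exists_extend ((Module.Basis.span hv).coord i)
    refine ⟨u, fun j => ?_⟩
    have h1 : u (v j) = (Module.Basis.span hv).coord i (Module.Basis.span hv j) := by
      rw [← hu, LinearMap.comp_apply, Submodule.subtype_apply, Module.Basis.span_apply]
    rw [h1, Module.Basis.coord_apply, Module.Basis.repr_self, Finsupp.single_apply]
    simp only [eq_comm]
  choose u hu using hex
  exact ⟨u, hu⟩

section Dimension

variable {V : Type*} [AddCommGroup V] [Module ℂ V] {Q : QuadraticForm ℂ V} {E F : Submodule ℂ V}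

namespace DualFrame

variable {h : ℕ} (S : DualFrame Q E F h)

/-! ### The charts as polynomial maps -/

theorem exists_eval_expList (l : List (IndexPair h)) (χ : Module.Dual ℂ (Spinors Q E)) :
    ∃ p : MvPolynomial (IndexPair h) ℂ, ∀ A, MvPolynomial.eval A p = χ (S.expList l A) := by
  induction l generalizing χ with
  | nil => exact ⟨MvPolynomial.C (χ 1), fun A => by rw [MvPolynomial.eval_C, expList_nil]⟩
  | cons q l ih =>
    obtain ⟨p₁, h₁⟩ := ih χ
    obtain ⟨p₂, h₂⟩ := ih (χ.comp (LinearMap.mulLeft ℂ (S.bivector q)))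
    refine ⟨p₁ + MvPolynomial.X q * p₂, fun A => ?_⟩
    rw [map_add, map_mul, h₁, h₂, MvPolynomial.eval_X, expList_cons, add_mul, one_mul, map_add,
      smul_mul_assoc, map_smul]
    rfl

theorem expList_zero (l : List (IndexPair h)) : S.expList l 0 = 1 := by
  induction l with
  | nil => rfl
  | cons p l ih => rw [expList_cons, ih, Pi.zero_apply, zero_smul, add_zero, mul_one]

theorem hasStrictFDerivAt_expList (l : List (IndexPair h)) (χ : Module.Dual ℂ (Spinors Q E)) :
    HasStrictFDerivAt (fun A => χ (S.expList l A)) ((l.map fun p => χ (S.bivector p) •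
      (ContinuousLinearMap.proj p : (IndexPair h → ℂ) →L[ℂ] ℂ)).sum) 0 := by
  induction l generalizing χ with
  | nil => exact hasStrictFDerivAt_const (E := IndexPair h → ℂ) (F := ℂ) (χ 1) 0
  | cons q l ih =>
    have h1 := ih χ
    have h2 := (ContinuousLinearMap.proj (R := ℂ) (φ := fun _ : IndexPair h => ℂ)
      q).hasStrictFDerivAt (x := 0) |>.mul (ih (χ.comp (LinearMap.mulLeft ℂ (S.bivector q))))
    have h3 : (fun A => χ (S.expList (q :: l) A)) = fun A => χ (S.expList l A) +
        (ContinuousLinearMap.proj (R := ℂ) (φ := fun _ : IndexPair h => ℂ) q) A *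
          (χ.comp (LinearMap.mulLeft ℂ (S.bivector q))) (S.expList l A) := by
      funext A
      rw [expList_cons, add_mul, one_mul, map_add, smul_mul_assoc, map_smul]
      rfl
    rw [h3]
    refine (h1.add h2).congr_fderiv ?_
    rw [List.map_cons, List.sum_cons, expList_zero, add_comm]
    ext t
    simp

/-- The words in the vectors `e_i + f_i`, of even length and without repetition: they index the
charts of the variety of even pure spinors. -/
abbrev EvenWord (h : ℕ) : Type := {l : List (Fin h) // l.Nodup ∧ Even l.length}

instance : Finite (EvenWord h) :=
  Finite.of_injective (fun l : EvenWord h => (⟨l.1, l.2.1⟩ : {l : List (Fin h) // l.Nodup}))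
    fun _ _ hll' => Subtype.ext (Subtype.mk.inj hll')

/-- The translate of the exponential chart by a word. -/
def chart (l : EvenWord h) (A : IndexPair h → ℂ) : EvenSpinors Q E :=
  ⟨S.flipAct l.1 (S.expChart A), S.flipAct_mem_even l.2.2 (S.expList_mem_even _ _)⟩

/-- The spinors spanning the affine tangent space of the translated chart at its origin: the origin
itself and the derivatives in the coordinate directions. -/
def tangent (l : EvenWord h) : Option (IndexPair h) → EvenSpinors Q E
  | none => ⟨S.flipAct l.1 1, S.flipAct_mem_even l.2.2 (S.expList_mem_even [] 0)⟩
  | some p => ⟨S.flipAct l.1 (S.bivector p), S.flipAct_mem_even l.2.2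
      (ι_mul_ι_mem_evenOdd_zero _ _ _)⟩

theorem chart_zero (l : EvenWord h) : S.chart l 0 = S.tangent l none :=
  Subtype.ext (congrArg (S.flipAct l.1) (S.expList_zero _))

theorem exists_extend (χ : Module.Dual ℂ (EvenSpinors Q E)) :
    ∃ χ' : Module.Dual ℂ (Spinors Q E), ∀ x, χ x = χ' x := by
  obtain ⟨χ', hχ'⟩ := LinearMap.exists_extend χ
  exact ⟨χ', fun x => (LinearMap.congr_fun hχ' x).symm⟩

theorem isPolynomialMap_chart (l : EvenWord h) : IsPolynomialMap (S.chart l) := by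
  intro χ
  obtain ⟨χ', hχ'⟩ := exists_extend χ
  obtain ⟨p, hp⟩ := S.exists_eval_expList Finset.univ.toList (χ'.comp (S.flipAct l.1))
  exact ⟨p, fun t => by rw [hp, hχ']; rfl⟩

theorem hasStrictFDerivAt_chart (l : EvenWord h) (χ : Module.Dual ℂ (EvenSpinors Q E)) :
    HasStrictFDerivAt (fun A => χ (S.chart l A)) (∑ p, χ (S.tangent l (some p)) •
      (ContinuousLinearMap.proj p : (IndexPair h → ℂ) →L[ℂ] ℂ)) 0 := by
  obtain ⟨χ', hχ'⟩ := exists_extend χ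
  have := S.hasStrictFDerivAt_expList Finset.univ.toList (χ'.comp (S.flipAct l.1))
  rw [Finset.sum_map_toList] at this
  simp only [hχ']
  exact this

/-- The parameters of the secant variety: two relative coefficients and a point in each of three
charts. -/
abbrev SecantParam (h : ℕ) : Type := Fin 2 ⊕ Fin 3 × IndexPair h

/-- The coefficients of a point of a plane spanned by three points, the first of them normalized
to `1`. -/
def secantCoeff (t : SecantParam h → ℂ) : Fin 3 → ℂ :=
  Fin.cons 1 fun k => 1 + t (Sum.inl k)

/-- The parametrization of the secant planes spanned by points of three charts. -/
def secantMap (a : Fin 3 → EvenWord h) (t : SecantParam h → ℂ) : EvenSpinors Q E :=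
  ∑ i, secantCoeff t i • S.chart (a i) fun p => t (Sum.inr (i, p))

theorem isPolynomialMap_secantMap (a : Fin 3 → EvenWord h) : IsPolynomialMap (S.secantMap a) := by
  intro χ
  choose p hp using fun i => S.isPolynomialMap_chart (a i) χ
  let c : Fin 3 → MvPolynomial (SecantParam h) ℂ :=
    Fin.cons 1 fun k => 1 + MvPolynomial.X (Sum.inl k)
  have hc : ∀ t i, MvPolynomial.eval t (c i) = secantCoeff t i := by
    intro t i
    refine Fin.cases ?_ (fun k => ?_) i
    · simp [c, secantCoeff]
    · simp [c, secantCoeff]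
  refine ⟨∑ i, c i * MvPolynomial.rename (fun q => Sum.inr (i, q)) (p i), fun t => ?_⟩
  rw [secantMap, map_sum, map_sum]
  refine Finset.sum_congr rfl fun i _ => ?_
  rw [map_mul, hc, MvPolynomial.eval_rename, map_smul, smul_eq_mul, ← hp]
  rfl

/-- The derivatives of the coefficients of a point of a secant plane. -/
def secantCoeffDeriv (h : ℕ) : Fin 3 → (SecantParam h → ℂ) →L[ℂ] ℂ :=
  Fin.cons 0 fun k => ContinuousLinearMap.proj (Sum.inl k)

theorem hasStrictFDerivAt_secantCoeff (i : Fin 3) :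
    HasStrictFDerivAt (fun t : SecantParam h → ℂ => secantCoeff t i) (secantCoeffDeriv h i) 0 := by
  refine Fin.cases ?_ (fun k => ?_) i
  · exact hasStrictFDerivAt_const _ _
  · exact (ContinuousLinearMap.proj (R := ℂ) (φ := fun _ : SecantParam h => ℂ)
      (Sum.inl k)).hasStrictFDerivAt.const_add 1

theorem secantCoeff_zero (i : Fin 3) : secantCoeff (h := h) 0 i = 1 := by
  refine Fin.cases rfl (fun k => ?_) i
  simp [secantCoeff]

theorem hasStrictFDerivAt_secantMap (a : Fin 3 → EvenWord h)
    (χ : Module.Dual ℂ (EvenSpinors Q E)) {L : (SecantParam h → ℂ) →L[ℂ] ℂ}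
    (hL : ∀ t, L t = ∑ i, ((∑ p, χ (S.tangent (a i) (some p)) * t (Sum.inr (i, p))) +
      χ (S.tangent (a i) none) * secantCoeffDeriv h i t)) :
    HasStrictFDerivAt (fun t => χ (S.secantMap a t)) L 0 := by
  have h1 : (fun t => χ (S.secantMap a t)) = fun t => ∑ i, secantCoeff t i *
      χ (S.chart (a i) fun p => t (Sum.inr (i, p))) := by
    funext t
    rw [secantMap, map_sum]
    simp only [map_smul, smul_eq_mul]
  rw [h1]
  let R : Fin 3 → (SecantParam h → ℂ) →L[ℂ] (IndexPair h → ℂ) := fun i =>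
    ContinuousLinearMap.pi fun p => ContinuousLinearMap.proj (Sum.inr (i, p))
  have h2 : ∀ i, HasStrictFDerivAt (fun t => χ (S.chart (a i) (R i t))) _ 0 := fun i =>
    HasStrictFDerivAt.comp (g := fun A => χ (S.chart (a i) A)) (f := R i) 0
      (by rw [map_zero]; exact S.hasStrictFDerivAt_chart (a i) χ) (R i).hasStrictFDerivAt
  refine (HasStrictFDerivAt.fun_sum (u := Finset.univ) fun i _ =>
    (hasStrictFDerivAt_secantCoeff i).mul (h2 i)).congr_fderiv ?_
  ext t
  rw [hL]
  simp only [secantCoeff_zero, map_zero, chart_zero, sum_apply,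
    add_apply, smul_apply, ContinuousLinearMap.comp_apply,
    smul_eq_mul, one_mul]
  rfl

/-! ### Independence of three tangent spaces -/

theorem hasWeight_tangent (l : EvenWord h) (o : Option (IndexPair h)) :
    S.HasWeight (symmDiff (o.elim ∅ fun p => {p.lo, p.hi}) l.1.toFinset)
      (S.tangent l o : Spinors Q E) := by
  cases o with
  | none => exact S.hasWeight_one.flipAct S l.2.1
  | some p => exact (S.hasWeight_bivector p).flipAct S l.2.1

theorem tangent_ne_zero (l : EvenWord h) (o : Option (IndexPair h)) :
    (S.tangent l o : Spinors Q E) ≠ 0 := by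
  have hinj := S.flipAct_injective l.1
  cases o with
  | none =>
    intro h0
    have h1 : (1 : Spinors Q E) = 0 := hinj (h0.trans (map_zero _).symm)
    have := congrArg S.aug h1
    simp at this
  | some p => exact fun h0 => S.bivector_ne_zero p (hinj (h0.trans (map_zero _).symm))

theorem pair_injective {o o' : Option (IndexPair h)}
    (hoo : (o.elim ∅ fun p => {p.lo, p.hi} : Finset (Fin h)) =
      o'.elim ∅ fun p => {p.lo, p.hi}) : o = o' := by
  cases o with
  | none =>
    cases o' with
    | none => rfl
    | some q => exact absurd hoo.symm (by simp)
  | some p =>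
    cases o' with
    | none => exact absurd hoo (by simp)
    | some q =>
      simp only [Option.elim_some] at hoo
      have hp := p.lo_lt_hi
      have hq := q.lo_lt_hi
      have h1 : p.lo ∈ ({q.lo, q.hi} : Finset (Fin h)) := hoo ▸ Finset.mem_insert_self _ _
      have h2 : p.hi ∈ ({q.lo, q.hi} : Finset (Fin h)) := hoo ▸ (by simp)
      have h3 : q.lo ∈ ({p.lo, p.hi} : Finset (Fin h)) := hoo ▸ Finset.mem_insert_self _ _
      simp only [Finset.mem_insert, Finset.mem_singleton] at h1 h2 h3
      congr 1
      apply IndexPair.ext_of_eq <;> grind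

/-- Tangent spaces at coordinate points at Hamming distance at least five are independent, since
their weights are disjoint. -/
theorem linearIndependent_tangent {ι' : Type*} {a : ι' → EvenWord h}
    (ha : ∀ i j, i ≠ j → 4 < (symmDiff (a i).1.toFinset (a j).1.toFinset).card) :
    LinearIndependent ℂ fun x : ι' × Option (IndexPair h) => S.tangent (a x.1) x.2 := by
  apply LinearIndependent.of_comp (EvenSpinors Q E).subtype
  refine S.linearIndependent_of_hasWeight
    (T := fun x : ι' × Option (IndexPair h) =>
      symmDiff (x.2.elim ∅ fun p => {p.lo, p.hi}) (a x.1).1.toFinset)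
    ?_ (fun x => S.hasWeight_tangent _ _) fun x => S.tangent_ne_zero _ _
  have hcard : ∀ o : Option (IndexPair h),
      (o.elim ∅ fun p => {p.lo, p.hi} : Finset (Fin h)).card ≤ 2 := by
    rintro (_ | p)
    · simp
    · exact Finset.card_le_two
  rintro ⟨i, o⟩ ⟨j, o'⟩ hij
  dsimp only at hij
  obtain rfl : i = j := by
    by_contra hne
    have h1 : symmDiff (a i).1.toFinset (a j).1.toFinset =
        symmDiff (o.elim ∅ fun p => {p.lo, p.hi}) (o'.elim ∅ fun p => {p.lo, p.hi}) := by
      have := congrArg (fun X => symmDiff (symmDiff (o.elim ∅ fun p => {p.lo, p.hi}) X)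
        (a j).1.toFinset) hij
      rw [symmDiff_symmDiff_cancel_left, symmDiff_assoc, symmDiff_symmDiff_cancel_right] at this
      exact this
    have h2 := ha i j hne
    rw [h1] at h2
    have h3 := (Finset.card_le_card (Finset.symmDiff_subset_union)).trans
      (Finset.card_union_le (o.elim ∅ fun p => {p.lo, p.hi} : Finset (Fin h))
        (o'.elim ∅ fun p => {p.lo, p.hi}))
    have h4 := hcard o
    have h5 := hcard o'
    omega
  rw [pair_injective (symmDiff_left_injective _ hij)]

/-- The linear forms exhibiting the secant parametrization as immersive, made from a family dual to
the three tangent spaces. At the origin all three coefficients are `1`, so the form of the first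
chart is subtracted from those which detect the other coefficients. -/
def secantForms {W : Type*} [AddCommGroup W] [Module ℂ W]
    (u : Fin 3 × Option (IndexPair h) → Module.Dual ℂ W) :
    Option (SecantParam h) → Module.Dual ℂ W
  | none => u (0, none)
  | some (Sum.inl k) => u (k.succ, none) - u (0, none)
  | some (Sum.inr (i, p)) => u (i, some p)

theorem isImmersiveAtZero_secantMap {a : Fin 3 → EvenWord h}
    {u : Fin 3 × Option (IndexPair h) → Module.Dual ℂ (EvenSpinors Q E)}
    (hu : ∀ x y, u x (S.tangent (a y.1) y.2) = if x = y then 1 else 0) :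
    IsImmersiveAtZero (S.secantMap a) (secantForms u) := by
  have hu' : ∀ i o j o', u (i, o) (S.tangent (a j) o') = if i = j ∧ o = o' then 1 else 0 :=
    fun i o j o' => by simpa [Prod.ext_iff] using hu (i, o) (j, o')
  have h0 : S.secantMap a 0 = ∑ i, S.tangent (a i) none := by
    rw [secantMap]
    refine Finset.sum_congr rfl fun i _ => ?_
    rw [secantCoeff_zero, one_smul, ← chart_zero]
    rfl
  refine ⟨fun o => ?_, fun o => S.hasStrictFDerivAt_secantMap a _ fun t => ?_⟩
  · rw [h0, map_sum]
    rcases o with _ | k | ⟨i, p⟩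
    · simp [secantForms, hu']
    · simp [secantForms, hu']
    · simp [secantForms, hu']
  · rcases o with _ | k | ⟨i, p⟩
    · simp [secantForms, hu', secantCoeffDeriv]
    · simp only [secantForms, hu', LinearMap.sub_apply]
      fin_cases k
      · simp [Fin.sum_univ_three, secantCoeffDeriv]
      · simp [Fin.sum_univ_three, secantCoeffDeriv]
        rfl
    · simp [secantForms, hu', ite_and, Finset.sum_ite_eq]

theorem isImmersiveAtZero_chart {l : EvenWord h}
    {u : Option (IndexPair h) → Module.Dual ℂ (EvenSpinors Q E)}
    (hu : ∀ o o', u o (S.tangent l o') = if o = o' then 1 else 0) :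
    IsImmersiveAtZero (S.chart l) u := by
  refine ⟨fun o => ?_, fun o => ?_⟩
  · rw [chart_zero, hu]
  · refine (S.hasStrictFDerivAt_chart l (u o)).congr_fderiv ?_
    ext t
    simp only [sum_apply, smul_apply, hu]
    cases o <;> simp

/-! ### Dimensions of the pure spinor variety and of its secant variety -/

theorem chart_ne_zero (l : EvenWord h) (A : IndexPair h → ℂ) : S.chart l A ≠ 0 := by
  intro h0
  have h1 : S.flipAct l.1 (S.expChart A) = 0 := congrArg Subtype.val h0
  have h2 : S.expChart A = 0 := S.flipAct_injective l.1 (h1.trans (map_zero _).symm)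
  have h3 := S.aug_expList Finset.univ.toList A
  rw [show S.expList Finset.univ.toList A = 0 from h2, map_zero] at h3
  exact zero_ne_one h3

theorem mk_chart_mem (hF : IsMaximalTotallyIsotropic Q F) (l : EvenWord h) (A : IndexPair h → ℂ) :
    Projectivization.mk ℂ (S.chart l A) (S.chart_ne_zero l A) ∈ evenPureSpinorVariety Q E F := by
  obtain ⟨c, hc⟩ := Projectivization.exists_smul_eq_mk_rep ℂ _ (S.chart_ne_zero l A)
  change IsPureSpinor Q E F (Subtype.val (Projectivization.rep _))
  rw [← hc]
  exact (S.isPureSpinor_flipAct l.1 (S.isPureSpinor_expList hF _ A)).smul c.ne_zero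

theorem exists_rep_eq_smul_chart [FiniteDimensional ℂ V] (hV : Module.finrank ℂ V = 2 * h)
    {x : ℙ ℂ (EvenSpinors Q E)} (hx : x ∈ evenPureSpinorVariety Q E F) :
    ∃ (l : EvenWord h) (c : ℂ) (A : IndexPair h → ℂ), x.rep = c • S.chart l A := by
  obtain ⟨l, hl, hlen, c, A, hA⟩ := S.exists_eq_smul_flipAct_expChart hV hx x.rep.2
  exact ⟨⟨l, hl, hlen⟩, c, A, Subtype.ext hA⟩

theorem evenPureSpinorVariety_subset [FiniteDimensional ℂ V] (hV : Module.finrank ℂ V = 2 * h) :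
    evenPureSpinorVariety Q E F ⊆ ⋃ l, projImage (S.chart l) := by
  intro x hx
  obtain ⟨l, c, A, hA⟩ := S.exists_rep_eq_smul_chart hV hx
  refine Set.mem_iUnion.2 ⟨l, A, S.chart_ne_zero l A, ?_⟩
  rw [← x.mk_rep, Projectivization.mk_eq_mk_iff']
  exact ⟨c, hA.symm⟩

/-- Every point of a secant plane lies in the image of a secant parametrization: order the three
points such that the first of them has a nonzero coefficient. -/
theorem secant_subset [FiniteDimensional ℂ V] (hV : Module.finrank ℂ V = 2 * h) :
    {y : ℙ ℂ (EvenSpinors Q E) | ∃ x : Fin 3 → ℙ ℂ (EvenSpinors Q E),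
      (∀ i, x i ∈ evenPureSpinorVariety Q E F) ∧ y.submodule ≤ ⨆ i, (x i).submodule} ⊆
      ⋃ a, projImage (S.secantMap a) := by
  rintro y ⟨x, hx, hy⟩
  choose l c A hA using fun i => S.exists_rep_eq_smul_chart hV (hx i)
  have hmem : y.rep ∈ ⨆ i, (x i).submodule := hy (by
    rw [Projectivization.submodule_eq]; exact Submodule.mem_span_singleton_self _)
  obtain ⟨g, hg⟩ : ∃ g : Fin 3 → ℂ, y.rep = ∑ i, g i • S.chart (l i) (A i) := by
    obtain ⟨v, hv⟩ := (Submodule.mem_iSup_iff_exists_finsupp _ _).1 hmem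
    have hv1 : ∀ i, ∃ b : ℂ, v i = b • S.chart (l i) (A i) := by
      intro i
      have := hv.1 i
      rw [Projectivization.submodule_eq, Submodule.mem_span_singleton] at this
      obtain ⟨b, hb⟩ := this
      exact ⟨b * c i, by rw [← hb, hA, smul_smul]⟩
    choose b hb using hv1
    refine ⟨b, ?_⟩
    rw [← hv.2, Finsupp.sum_fintype _ _ fun _ => rfl]
    exact Finset.sum_congr rfl fun i _ => hb i
  obtain ⟨i₀, hi₀⟩ : ∃ i, g i ≠ 0 := by
    by_contra! h0
    exact y.rep_nonzero (by rw [hg]; simp [h0])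
  let σ : Equiv.Perm (Fin 3) := Equiv.swap 0 i₀
  have hσ : g (σ 0) ≠ 0 := by rwa [Equiv.swap_apply_left]
  let t : SecantParam h → ℂ := Sum.elim (fun k => g (σ k.succ) / g (σ 0) - 1)
    fun q => A (σ q.1) q.2
  have ht : y.rep = g (σ 0) • S.secantMap (fun i => l (σ i)) t := by
    rw [hg, ← Equiv.sum_comp σ, secantMap, Finset.smul_sum]
    refine Finset.sum_congr rfl fun i _ => ?_
    rw [smul_smul]
    congr 1
    refine Fin.cases ?_ (fun k => ?_) i
    · simp [secantCoeff]
    · simp only [secantCoeff, Fin.cons_succ, t, Sum.elim_inl]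
      field_simp
      ring
  have hne : S.secantMap (fun i => l (σ i)) t ≠ 0 := fun h0 =>
    y.rep_nonzero (by rw [ht, h0, smul_zero])
  refine Set.mem_iUnion.2 ⟨fun i => l (σ i), t, hne, ?_⟩
  rw [← y.mk_rep, Projectivization.mk_eq_mk_iff']
  exact ⟨_, ht.symm⟩

theorem projImage_secantMap_subset (hF : IsMaximalTotallyIsotropic Q F) (a : Fin 3 → EvenWord h) :
    projImage (S.secantMap a) ⊆ secantVariety 3 (evenPureSpinorVariety Q E F) := by
  rintro _ ⟨t, ht, rfl⟩
  refine subset_closure ⟨fun i => _, fun i => S.mk_chart_mem hF (a i) fun p => t (Sum.inr (i, p)),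
    ?_⟩
  rw [Projectivization.submodule_mk, Submodule.span_singleton_le_iff_mem, secantMap]
  refine Submodule.sum_mem _ fun i _ => Submodule.smul_mem _ _ ?_
  refine Submodule.mem_iSup_of_mem i ?_
  rw [Projectivization.submodule_mk]
  exact Submodule.mem_span_singleton_self _

/-- Three words at mutual Hamming distance at least six. -/
theorem exists_distant_words (hh : 12 ≤ h) : ∃ a : Fin 3 → EvenWord h,
    ∀ i j, i ≠ j → 4 < (symmDiff (a i).1.toFinset (a j).1.toFinset).card := by
  let f : Fin 6 → Fin h := fun i => ⟨i, by omega⟩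
  let g : Fin 6 → Fin h := fun i => ⟨i + 6, by omega⟩
  have hf : Function.Injective f := fun i j hij => Fin.ext (Fin.mk.inj hij)
  have hg : Function.Injective g := fun i j hij => Fin.ext (by simpa [g] using hij)
  let wf : EvenWord h := ⟨(List.finRange 6).map f, (List.nodup_finRange 6).map hf, by
    rw [List.length_map, List.length_finRange]; decide⟩
  let wg : EvenWord h := ⟨(List.finRange 6).map g, (List.nodup_finRange 6).map hg, by
    rw [List.length_map, List.length_finRange]; decide⟩
  let w0 : EvenWord h := ⟨[], List.nodup_nil, by simp⟩
  have cf : wf.1.toFinset.card = 6 := by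
    rw [List.toFinset_card_of_nodup wf.2.1]; simp [wf]
  have cg : wg.1.toFinset.card = 6 := by
    rw [List.toFinset_card_of_nodup wg.2.1]; simp [wg]
  have c0 : w0.1.toFinset = ∅ := rfl
  have hl : ∀ X : Finset (Fin h), symmDiff ∅ X = X := bot_symmDiff
  have hr : ∀ X : Finset (Fin h), symmDiff X ∅ = X := symmDiff_bot
  have hd : Disjoint wf.1.toFinset wg.1.toFinset := by
    rw [Finset.disjoint_left]
    intro x hx hx'
    obtain ⟨i, -, rfl⟩ := List.mem_map.1 (List.mem_toFinset.1 hx)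
    obtain ⟨j, -, hij⟩ := List.mem_map.1 (List.mem_toFinset.1 hx')
    have := Fin.mk.inj hij
    omega
  have cfg : (symmDiff wf.1.toFinset wg.1.toFinset).card = 12 := by
    rw [hd.symmDiff_eq_sup, Finset.sup_eq_union, Finset.card_union_of_disjoint hd, cf, cg]
  refine ⟨![w0, wf, wg], fun i j hij => ?_⟩
  fin_cases i <;> fin_cases j <;>
    simp [c0, hl, hr, cf, cg, cfg, symmDiff_comm wg.1.toFinset] at hij ⊢

end DualFrame

end Dimension

end SpinorSecant

end

/-! ### The dimension of the secant variety -/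

open SpinorSecant in
theorem theorem6p2 (h : ℕ) (hh : 12 ≤ h) {V : Type*} [AddCommGroup V] [Module ℂ V]
    (hV : Module.finrank ℂ V = 2 * h) (Q : QuadraticForm ℂ V)
    (hQ : LinearMap.BilinForm.Nondegenerate (QuadraticMap.associated (R := ℂ) Q))
    (E F : Submodule ℂ V)
    (hE : SpinorSecant.IsMaximalTotallyIsotropic Q E)
    (hF : SpinorSecant.IsMaximalTotallyIsotropic Q F) (hEF : IsCompl E F) :
    SpinorSecant.HasExpectedDimension 3 (SpinorSecant.evenPureSpinorVariety Q E F) ∧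
      SpinorSecant.zariskiDim
          (SpinorSecant.secantVariety 3 (SpinorSecant.evenPureSpinorVariety Q E F)) =
        ((3 * (h * (h - 1) / 2) + 2 : ℕ) : WithBot ℕ∞) := by
  have : FiniteDimensional ℂ V := Module.finite_of_finrank_pos (by omega)
  obtain ⟨S⟩ := exists_dualFrame hV hQ hE.1 hF.1 hEF
  have := S.finiteDimensional_spinors
  obtain ⟨a, ha⟩ := DualFrame.exists_distant_words hh
  have hind := S.linearIndependent_tangent ha
  obtain ⟨u, hu⟩ := exists_dual_family hind
  have hcard := IndexPair.card (h := h)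
  have hdim : zariskiDim (evenPureSpinorVariety Q E F) = (h * (h - 1) / 2 : ℕ) := by
    apply le_antisymm
    · have := zariskiDim_le_of_subset_closure S.isPolynomialMap_chart
        ((S.evenPureSpinorVariety_subset hV).trans subset_closure)
      rwa [Nat.card_eq_fintype_card, hcard] at this
    · rw [← hcard]
      refine le_zariskiDim_of_projImage_subset (S.isPolynomialMap_chart (a 0))
        (S.isImmersiveAtZero_chart (u := fun o => u (0, o)) fun o o' => ?_) ?_
      · simpa using hu (0, o) (0, o')
      · rintro _ ⟨t, ht, rfl⟩
        exact S.mk_chart_mem hF (a 0) t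
  have hcard' : Fintype.card (DualFrame.SecantParam h) = 3 * (h * (h - 1) / 2) + 2 := by
    rw [Fintype.card_sum, Fintype.card_prod, hcard, Fintype.card_fin, Fintype.card_fin, add_comm]
  have hsec : zariskiDim (secantVariety 3 (evenPureSpinorVariety Q E F)) =
      (3 * (h * (h - 1) / 2) + 2 : ℕ) := by
    apply le_antisymm
    · have := zariskiDim_le_of_subset_closure S.isPolynomialMap_secantMap
        (closure_mono (S.secant_subset hV))
      rwa [Nat.card_eq_fintype_card, hcard'] at this
    · rw [← hcard']
      exact le_zariskiDim_of_projImage_subset (S.isPolynomialMap_secantMap a)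
        (S.isImmersiveAtZero_secantMap hu) (S.projImage_secantMap_subset hF a)
  refine ⟨⟨_, hdim, ?_⟩, hsec⟩
  -- the independent tangent spaces fit into the space of even spinors
  have hfin := hind.fintype_card_le_finrank
  rw [Fintype.card_prod, Fintype.card_option, hcard, Fintype.card_fin] at hfin
  rw [hsec, min_eq_left (by omega)]
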